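/- Let $d\ge 1$, let $\Omega\subset\mathbb R^d$ be an open set (for instance a Lipschitz domain), let $T>0$ and $I=(0,T)$. Let $a_{ij}\in L^\infty(I\times\Omega)$, $1\le i,j\le d$, satisfy $a_{ij}=a_{ji}$ and, for some $\alpha>0$, $\sum_{i,j}a_{ij}(t,x)\xi_i\xi_j\ge\alpha|\xi|^2$ for all $\xi\in\mathbb R^d$ and a.e. $(t,x)\in I\times\Omega$. Let $a_{ij}(\cdot,x)$ be continuous on $[0,T]$ for a.e. $x\in\Omega$, and let $|a_{ij}(t_1,x)-a_{ij}(t_2,x)|\le\omega(|t_1-t_2|)$ for all $t_1,t_2\in[0,T]$ and a.e. $x\in\Omega$, where $\omega:[0,T]\to[0,\infty)$ is nondecreasing, $t\mapsto\omega(t)t^{-3/2}$ is nonincreasing on $(0,T]$, and $\int_0^T\omega(t)t^{-3/2}\,dt<\infty$. Put $a(t;u,v)=\int_\Omega\sum_{i,j}a_{ij}(t,x)\,\partial_iu\,\partial_jv\,dx$ for $u,v\in H^1_0(\Omega)$, and let $A(t):H^1_0(\Omega)\to H^{-1}(\Omega)$ be given by $\langle A(t)u,v\rangle=a(t;u,v)$.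 For a partition $0=t_0<t_1<\dots<t_M=T$ write $I_m=(t_{m-1},t_m]$, $k_m=t_m-t_{m-1}$, $k=\max_mk_m$, $k_{\min}=\min_mk_m$ and $A_{k,m}=\frac1{k_m}\int_{I_m}A(t)\,dt$. Let $X_k^0$ be the space of functions of time that are constant on each $I_m$ with values in $H^1_0(\Omega)$, and write $v_{k,m}=v_k|_{I_m}$ for $v_k\in X_k^0$. For $f\in L^1(I;L^2(\Omega))$ and $u_0\in L^2(\Omega)$, the dG(0) semidiscrete solution is the $u_k\in X_k^0$ such that for all $\varphi_k\in X_k^0$ $$\int_I a(t;u_k(t),\varphi_k(t))\,dt+\sum_{m=2}^M(u_{k,m}-u_{k,m-1},\varphi_{k,m})_{L^2(\Omega)}+(u_{k,1},\varphi_{k,1})_{L^2(\Omega)}=\int_I(f(t),\varphi_k(t))_{L^2(\Omega)}\,dt+(u_0,\varphi_{k,1})_{L^2(\Omega)}.$$ Set $[u_k]_{m-1}=u_{k,m}-u_{k,m-1}$ for $1\le m\le M$, where $u_{k,0}:=u_0$. Fix constants $c,\beta,\kappa>0$. Then there are $\mu>0$, $\delta_0>0$ and $C>0$ such that the following holds for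 every partition with $k_{\min}\ge ck^\beta$, $\kappa^{-1}\le k_m/k_{m+1}\le\kappa$ for $1\le m\le M-1$, $k\le T/4$ and $k-k_{\min}\le\delta_0$, for every $1\le p<\infty$ and every $f\in L^p(I;L^2(\Omega))$: the dG(0) semidiscrete solution $u_k$ with $u_0=0$ satisfies $A_{k,m}u_{k,m}\in L^2(\Omega)$ for $1\le m\le M$ and $$\left[\sum_{m=1}^M\left(\|A_{k,m}u_{k,m}\|^p_{L^p(I_m;L^2(\Omega))}+k_m\left\|\frac{[u_k]_{m-1}}{k_m}\right\|^p_{L^2(\Omega)}\right)\right]^{1/p}\le C\,e^{\mu T}\,\ln\frac Tk\,\|f\|_{L^p(I;L^2(\Omega))}.$$ -/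

import Mathlib

open MeasureTheory Set

noncomputable section

namespace DG

/-- `ℝ^d` with the Euclidean norm. -/
abbrev Space (d : ℕ) : Type := EuclideanSpace ℝ (Fin d)

/-- The real Hilbert space `L²(Ω)`. -/
abbrev L2 {d : ℕ} (Ω : Set (Space d)) : Type :=
  Lp ℝ 2 ((volume : Measure (Space d)).restrict Ω)

/-- The Hilbert space `L²(Ω) × L²(Ω)^d` of pairs (function, gradient field), with norm
`(‖u‖² + ∑ i, ‖G i‖²)^(1/2)`. On pairs `(u, ∇u)` this is the `H¹(Ω)` norm. -/
abbrev Pairs {d : ℕ} (Ω : Set (Space d)) : Type :=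
  WithLp 2 (L2 Ω × PiLp 2 (fun _ : Fin d => L2 Ω))

/-- The partial derivative `∂_i φ` of a function on `ℝ^d`. -/
def pderiv {d : ℕ} (i : Fin d) (φ : Space d → ℝ) (x : Space d) : ℝ :=
  fderiv ℝ φ x (EuclideanSpace.single i 1)

/-- The pairs `(φ, ∇φ)` with `φ ∈ C_c^∞(Ω)`. -/
def testPairs {d : ℕ} (Ω : Set (Space d)) : Submodule ℝ (Pairs Ω) where
  carrier := {w | ∃ φ : Space d → ℝ, ContDiff ℝ ((⊤ : ℕ∞) : WithTop ℕ∞) φ ∧ HasCompactSupport φ ∧ tsupport φ ⊆ Ω ∧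
    w.fst =ᵐ[volume.restrict Ω] φ ∧ ∀ i, w.snd i =ᵐ[volume.restrict Ω] pderiv i φ}
  zero_mem' := by
    refine ⟨0, contDiff_const, HasCompactSupport.zero, by simp [tsupport], ?_, fun i => ?_⟩
    · exact Lp.coeFn_zero ℝ 2 _
    · filter_upwards [Lp.coeFn_zero ℝ 2 (volume.restrict Ω)] with x hx
      have h0 : pderiv i (0 : Space d → ℝ) x = 0 := by simp [pderiv]
      rw [h0]
      exact hx
  add_mem' := by
    rintro v w ⟨φ, hφ, hφc, hφs, hv, hv'⟩ ⟨ψ, hψ, hψc, hψs, hw, hw'⟩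
    refine ⟨φ + ψ, hφ.add hψ, hφc.add hψc,
      (tsupport_add φ ψ).trans (union_subset hφs hψs), ?_, fun i => ?_⟩
    · filter_upwards [Lp.coeFn_add v.fst w.fst, hv, hw] with x h h1 h2
      rw [WithLp.add_fst, h, Pi.add_apply, Pi.add_apply, h1, h2]
    · filter_upwards [Lp.coeFn_add (v.snd i) (w.snd i), hv' i, hw' i] with x h h1 h2
      have hd : pderiv i (φ + ψ) x = pderiv i φ x + pderiv i ψ x := by
        unfold pderiv
        rw [fderiv_add (hφ.differentiable (by simp) x) (hψ.differentiable (by simp) x)]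
        rfl
      rw [WithLp.add_snd, PiLp.add_apply, h, Pi.add_apply, h1, h2, hd]
  smul_mem' := by
    rintro r w ⟨ψ, hψ, hψc, hψs, hw, hw'⟩
    refine ⟨r • ψ, contDiff_const.smul hψ, hψc.smul_left (f := fun _ => r),
      (tsupport_smul_subset_right (fun _ => r) ψ).trans hψs, ?_, fun i => ?_⟩
    · filter_upwards [Lp.coeFn_smul r w.fst, hw] with x h h2
      rw [WithLp.smul_fst, h, Pi.smul_apply, Pi.smul_apply, h2]
    · filter_upwards [Lp.coeFn_smul r (w.snd i), hw' i] with x h h2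
      have hd : pderiv i (r • ψ) x = r • pderiv i ψ x := by
        unfold pderiv
        rw [fderiv_const_smul (hψ.differentiable (by simp) x)]
        rfl
      rw [WithLp.smul_snd, PiLp.smul_apply, h, Pi.smul_apply, h2, hd]

/-- The Sobolev space `H¹₀(Ω)`: the closure of `C_c^∞(Ω)` in the `H¹(Ω)` norm. An element is
stored as the pair `(u, ∇u)`; the (weak) gradient is determined by `u`. -/
def H10 {d : ℕ} (Ω : Set (Space d)) : Submodule ℝ (Pairs Ω) :=
  (testPairs Ω).topologicalClosure

/-- An element of `H¹₀(Ω)` as an element of `L²(Ω)`. -/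
def toL2 {d : ℕ} {Ω : Set (Space d)} (u : H10 Ω) : L2 Ω := (u : Pairs Ω).fst

/-- The weak partial derivative `∂_i u` of `u ∈ H¹₀(Ω)`. -/
def partialD {d : ℕ} {Ω : Set (Space d)} (i : Fin d) (u : H10 Ω) : L2 Ω := (u : Pairs Ω).snd i

/-- Time-dependent coefficients `a i j t x`. -/
abbrev Coeff (d : ℕ) : Type := Fin d → Fin d → ℝ → Space d → ℝ

/-- The assumptions on the modulus of continuity `ω : [0,T] → [0,∞)`. -/
structure IsModulus (T : ℝ) (ω : ℝ → ℝ) : Prop where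
  nonneg : ∀ t ∈ Icc 0 T, 0 ≤ ω t
  monotoneOn : MonotoneOn ω (Icc 0 T)
  antitoneOn : AntitoneOn (fun t => ω t / t ^ (3 / 2 : ℝ)) (Ioc 0 T)
  integrableOn : IntegrableOn (fun t => ω t / t ^ (3 / 2 : ℝ)) (Ioc 0 T)

/-- The assumptions on the coefficients: bounded and measurable on `I × Ω`, symmetric, uniformly
elliptic with constant `α`, and continuous in time with modulus of continuity `ω`. -/
structure IsAdmissibleCoeff {d : ℕ} (Ω : Set (Space d)) (T : ℝ) (a : Coeff d) (α : ℝ)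
    (ω : ℝ → ℝ) : Prop where
  memLp_top : ∀ i j, MemLp (fun z : ℝ × Space d => a i j z.1 z.2) ⊤
    ((volume.restrict (Ioo 0 T)).prod (volume.restrict Ω))
  symm : ∀ i j, ∀ᵐ z : ℝ × Space d ∂((volume.restrict (Ioo 0 T)).prod (volume.restrict Ω)),
    a i j z.1 z.2 = a j i z.1 z.2
  elliptic : ∀ᵐ z : ℝ × Space d ∂((volume.restrict (Ioo 0 T)).prod (volume.restrict Ω)),
    ∀ ξ : Space d, α * ‖ξ‖ ^ 2 ≤ ∑ i, ∑ j, a i j z.1 z.2 * ξ i * ξ j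
  continuousOn : ∀ i j, ∀ᵐ x ∂(volume.restrict Ω), ContinuousOn (fun t => a i j t x) (Icc 0 T)
  modulus : ∀ i j, ∀ t₁ ∈ Icc 0 T, ∀ t₂ ∈ Icc 0 T, ∀ᵐ x ∂(volume.restrict Ω),
    |a i j t₁ x - a i j t₂ x| ≤ ω |t₁ - t₂|

/-- The bilinear form `a(t; u, v) = ∫_Ω ∑ i j, a_ij(t,x) ∂_i u(x) ∂_j v(x) dx`. It is also the
value `⟨A(t) u, v⟩` of the elliptic operator `A(t) : H¹₀(Ω) → H⁻¹(Ω)`. -/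
def form {d : ℕ} {Ω : Set (Space d)} (a : Coeff d) (t : ℝ) (u v : H10 Ω) : ℝ :=
  ∫ x in Ω, ∑ i, ∑ j, a i j t x * partialD i u x * partialD j v x

/-- A partition `0 = t_0 < t_1 < ⋯ < t_M = T` of `(0,T]` (the values `t m` with `m > M` play no
role). -/
structure TimeMesh (T : ℝ) where
  M : ℕ
  one_le : 1 ≤ M
  t : ℕ → ℝ
  t_zero : t 0 = 0
  t_last : t M = T
  t_lt : ∀ m < M, t m < t (m + 1)

namespace TimeMesh

variable {T : ℝ} (𝒯 : TimeMesh T)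

/-- The time step `k_m = t_m - t_{m-1}`, for `1 ≤ m ≤ M`. -/
def step (m : ℕ) : ℝ := 𝒯.t m - 𝒯.t (m - 1)

/-- The time interval `I_m = (t_{m-1}, t_m]`, for `1 ≤ m ≤ M`. -/
def interval (m : ℕ) : Set ℝ := Ioc (𝒯.t (m - 1)) (𝒯.t m)

/-- The maximal time step `k`. -/
def kMax : ℝ := (Finset.Icc 1 𝒯.M).sup' (Finset.nonempty_Icc.2 𝒯.one_le) 𝒯.step

/-- The minimal time step `k_min`. -/
def kMin : ℝ := (Finset.Icc 1 𝒯.M).inf' (Finset.nonempty_Icc.2 𝒯.one_le) 𝒯.step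

/-- The conditions on the time mesh, with constants `c, β, κ`. -/
structure IsAdmissible (c β κ : ℝ) : Prop where
  kMin_ge : c * 𝒯.kMax ^ β ≤ 𝒯.kMin
  ratio : ∀ m, 1 ≤ m → m < 𝒯.M →
    κ⁻¹ ≤ 𝒯.step m / 𝒯.step (m + 1) ∧ 𝒯.step m / 𝒯.step (m + 1) ≤ κ
  kMax_le : 𝒯.kMax ≤ T / 4

end TimeMesh

/-- The bilinear form `B(u_k, φ_k)` of the discontinuous Galerkin method on the space `X_k^0` of
functions that are constant in time on each `I_m`. Such a function is given by its values
`u m = u_{k,m} ∈ H¹₀(Ω)` on `I_m`, `1 ≤ m ≤ M` (other values of `u` play no role); the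
terms with `∂_t u_k` vanish on each `I_m`, and `[u_k]_{m-1} = u_{k,m} - u_{k,m-1}`. -/
def formB {d : ℕ} {Ω : Set (Space d)} {T : ℝ} (a : Coeff d) (𝒯 : TimeMesh T)
    (u φ : ℕ → H10 Ω) : ℝ :=
  (∑ m ∈ Finset.Icc 1 𝒯.M, ∫ s in 𝒯.interval m, form a s (u m) (φ m))
    + (∑ m ∈ Finset.Icc 2 𝒯.M, inner ℝ (toL2 (u m) - toL2 (u (m - 1))) (toL2 (φ m)))
    + inner ℝ (toL2 (u 1)) (toL2 (φ 1))

/-- `u` (that is, the function with value `u m` on `I_m`) is the dG(0) semidiscrete solution with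
initial value `u₀` and right-hand side `f`: for all `φ_k ∈ X_k^0`,
`B(u_k, φ_k) = (f, φ_k)_{I × Ω} + (u₀, φ_{k,1})_Ω`. -/
def IsDG0Solution {d : ℕ} {Ω : Set (Space d)} {T : ℝ} (a : Coeff d) (𝒯 : TimeMesh T)
    (u₀ : L2 Ω) (f : ℝ → L2 Ω) (u : ℕ → H10 Ω) : Prop :=
  ∀ φ : ℕ → H10 Ω, formB a 𝒯 u φ =
    (∑ m ∈ Finset.Icc 1 𝒯.M, ∫ s in 𝒯.interval m, inner ℝ (f s) (toL2 (φ m)))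
      + inner ℝ u₀ (toL2 (φ 1))

/-- The averaged operator `A_{k,m} = k_m⁻¹ ∫_{I_m} A(s) ds : H¹₀(Ω) → H⁻¹(Ω)`, given by its values
`⟨A_{k,m} u, v⟩`. -/
def avgOp {d : ℕ} {Ω : Set (Space d)} {T : ℝ} (a : Coeff d) (𝒯 : TimeMesh T) (m : ℕ)
    (u v : H10 Ω) : ℝ :=
  (𝒯.step m)⁻¹ * ∫ s in 𝒯.interval m, form a s u v

/-- The functional `F` on `H¹₀(Ω)` is the element `g` of `L²(Ω)`, i.e. `⟨F, v⟩ = (g, v)_Ω` for all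
`v ∈ H¹₀(Ω)`. For open `Ω` there is at most one such `g`, by density of `H¹₀(Ω)` in `L²(Ω)`. -/
def IsL2Rep {d : ℕ} {Ω : Set (Space d)} (F : H10 Ω → ℝ) (g : L2 Ω) : Prop :=
  ∀ v : H10 Ω, F v = inner ℝ g (toL2 v)

/-- The jump `[u_k]_{m-1}` at `t_{m-1}`, `1 ≤ m ≤ M`, where the value of `u_k` before time `0` is
the initial value `u₀`. -/
def jump {d : ℕ} {Ω : Set (Space d)} (u₀ : L2 Ω) (u : ℕ → H10 Ω) (m : ℕ) : L2 Ω :=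
  toL2 (u m) - if m = 1 then u₀ else toL2 (u (m - 1))

/-- The norm of `L^p(S; L²(Ω))` for a set `S` of times (for functions in that space). -/
def timeNorm {d : ℕ} {Ω : Set (Space d)} (p : ℝ) (S : Set ℝ) (f : ℝ → L2 Ω) : ℝ :=
  (eLpNorm f (ENNReal.ofReal p) (volume.restrict S)).toReal

end DG

end

/-! The proof is a discrete Duhamel argument with the operator frozen at the last step, followed by
a Gronwall argument. Indices are zero-based: `U (i+1)` is the nodal value, `g i` is the averaged
operator applied to it, and `f i` is the mean of the forcing. The scheme itself puts `g i` in `L²`,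
since it equals `f i` minus the difference quotient.

Fix `m` and let `A` be the averaged operator on the last interval. Starting from `φ = g m`, run
implicit Euler for `A` through the mesh steps in reverse order, with iterates `z n`. Pairing the
scheme with `A (z n)` and telescoping (`IsEulerScheme.inner_eq`) expresses `‖g m‖²` through `f` and
the differences between `A` and the earlier operators.

An energy inequality (`IsResolventChain.energy`) gives the parabolic smoothing of the chain: after
elapsed time `τ`, `‖A z‖ ≤ ‖φ‖ / τ` and `‖A^(3/2) z‖ ≤ (3 + κ) ‖φ‖ / τ^(3/2)`. The first bound
controls the forcing terms. In the perturbation terms, the coefficients differ by at most `ω τ`, the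
gradient of the test function `A z` is controlled by `A^(3/2) z`, and the energy identity bounds the
gradient of the solution by a multiple of `‖g l‖ + ‖U (l+1)‖`. Hence `‖g m‖ ≤ ∑ k_l ‖f l‖ / τ + C ∑
k_l (ω τ / τ^(3/2)) (‖g l‖ + ‖U (l+1)‖)`, where `τ = t (m+1) - t l`.

Both sums are convolutions with nonincreasing kernels, bounded on weighted `ℓ^p` by the kernel's
integral (`seqNorm_conv_le`, from Schur's test). Since `τ ≥ k_min`, the kernel `1/τ` may be cut off
at `k_min`, which costs `1 + log (T / k_min)`; this is the source of the logarithm. The kernel `ω τ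
/ τ^(3/2)` is integrable, so an exponential weight makes its mass small and its term is absorbed
(`seqNorm_gronwall`). Finally `k_min ≥ c k^β` turns `log (T / k_min)` into a multiple of `log (T /
k)`, and the jumps are recovered from the equation. -/

namespace DG

/-! ### Smoothing estimates for implicit Euler with a fixed symmetric operator -/

section Resolvent

variable {V H : Type*} [NormedAddCommGroup V] [InnerProductSpace ℝ V]
  [NormedAddCommGroup H] [InnerProductSpace ℝ H]

/-- The resolvent equation `z + k A z = φ` of a coercive form is solvable. -/
theorem exists_resolvent [CompleteSpace V] (j : V →L[ℝ] H) (B : V →L[ℝ] V →L[ℝ] ℝ)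
    (hB0 : ∀ v, 0 ≤ B v v) {c : ℝ} (hc : 0 < c)
    (hcoer : ∀ v, c * ‖v‖ ^ 2 ≤ ‖j v‖ ^ 2 + B v v) {k : ℝ} (hk : 0 < k) (φ : H) :
    ∃ z : V, ∀ v, inner ℝ (j z) (j v) + k * B z v = inner ℝ φ (j v) := by
  let I : H →L[ℝ] H →L[ℝ] ℝ := innerSL ℝ
  let P : V →L[ℝ] V →L[ℝ] ℝ := I.bilinearComp j j
  let G : V →L[ℝ] V →L[ℝ] ℝ := P + k • B
  have hG : ∀ u v, G u v = inner ℝ (j u) (j v) + k * B u v := fun u v => by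
    simp only [G, P, I, add_apply, smul_apply, smul_eq_mul, ContinuousLinearMap.bilinearComp_apply]
    rfl
  have hco : IsCoercive G := by
    refine ⟨min 1 k * c, by positivity, fun u => ?_⟩
    rw [hG, real_inner_self_eq_norm_sq]
    have h1 : min 1 k ≤ 1 := min_le_left _ _
    have h2 : min 1 k ≤ k := min_le_right _ _
    have h3 : 0 < min 1 k := lt_min one_pos hk
    calc min 1 k * c * ‖u‖ * ‖u‖ = min 1 k * (c * ‖u‖ ^ 2) := by ring
      _ ≤ min 1 k * (‖j u‖ ^ 2 + B u u) := by gcongr; exact hcoer u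
      _ = min 1 k * ‖j u‖ ^ 2 + min 1 k * B u u := by ring
      _ ≤ 1 * ‖j u‖ ^ 2 + k * B u u := by
          have := hB0 u
          gcongr
      _ = _ := by ring
  let ℓ : V →L[ℝ] ℝ := (innerSL ℝ φ).comp j
  let r : V := (InnerProductSpace.toDual ℝ V).symm ℓ
  refine ⟨hco.continuousLinearEquivOfBilin.symm r, fun v => ?_⟩
  rw [← hG, ← hco.continuousLinearEquivOfBilin_apply, ContinuousLinearEquiv.apply_symm_apply,
    InnerProductSpace.toDual_symm_apply]
  simp [ℓ]

/-- A chain of resolvent steps for the operator `A` of a coercive form: `z n` are the iterates,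
`w n = A (z n)` and `y n` is `w n` as an element of `V`. -/
structure IsResolventChain (j : V →L[ℝ] H) (B : V →L[ℝ] V →L[ℝ] ℝ) (h : ℕ → ℝ) (φ : H)
    (z : ℕ → V) (w : ℕ → H) (y : ℕ → V) : Prop where
  start : φ = j (z 0) + h 0 • w 0
  next : ∀ n, z n = z (n + 1) + h (n + 1) • y (n + 1)
  lift : ∀ n, j (y (n + 1)) = w (n + 1)
  apply_z : ∀ n v, B (z n) v = inner ℝ (w n) (j v)
  apply_y : ∀ n v, h (n + 1) * B (y (n + 1)) v = inner ℝ (w n - w (n + 1)) (j v)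

/-- `A (z n)` is read off as a difference quotient of the iterates. The initial `φ` lies only in
`H`, so `w 0` does too; from index 1 on, the quotient is formed from elements of `V` and lifts to
`y`. -/
theorem exists_resolventChain [CompleteSpace V] (j : V →L[ℝ] H) (B : V →L[ℝ] V →L[ℝ] ℝ)
    (hB0 : ∀ v, 0 ≤ B v v) {c : ℝ} (hc : 0 < c)
    (hcoer : ∀ v, c * ‖v‖ ^ 2 ≤ ‖j v‖ ^ 2 + B v v) (h : ℕ → ℝ) (hh : ∀ n, 0 < h n) (φ : H) :
    ∃ z w y, IsResolventChain j B h φ z w y := by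
  choose R hR using fun (k : {k : ℝ // 0 < k}) (ψ : H) =>
    exists_resolvent j B hB0 hc hcoer k.2 ψ
  let z : ℕ → V := fun n => Nat.rec (R ⟨h 0, hh 0⟩ φ)
    (fun n u => R ⟨h (n + 1), hh (n + 1)⟩ (j u)) n
  let y : ℕ → V := fun n => (h n)⁻¹ • (z (n - 1) - z n)
  let w : ℕ → H := fun n => Nat.casesOn n ((h 0)⁻¹ • (φ - j (z 0))) (fun n => j (y (n + 1)))
  have hz0 : ∀ v, inner ℝ (j (z 0)) (j v) + h 0 * B (z 0) v = inner ℝ φ (j v) :=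
    hR ⟨h 0, hh 0⟩ φ
  have hz : ∀ n v, inner ℝ (j (z (n + 1))) (j v) + h (n + 1) * B (z (n + 1)) v
      = inner ℝ (j (z n)) (j v) := fun n => hR ⟨h (n + 1), hh (n + 1)⟩ (j (z n))
  have hy : ∀ n, y (n + 1) = (h (n + 1))⁻¹ • (z n - z (n + 1)) := fun n => rfl
  have hw : ∀ n, w (n + 1) = j (y (n + 1)) := fun n => rfl
  have hw0 : w 0 = (h 0)⁻¹ • (φ - j (z 0)) := rfl
  have hne : ∀ n, h n ≠ 0 := fun n => (hh n).ne'
  have happ : ∀ n v, B (z n) v = inner ℝ (w n) (j v) := by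
    intro n v
    cases n with
    | zero =>
      rw [hw0, real_inner_smul_left, inner_sub_left, ← hz0]
      field_simp [hne 0]
      ring
    | succ n =>
      rw [hw, hy, map_smul, map_sub, real_inner_smul_left, inner_sub_left, ← hz n]
      field_simp [hne (n + 1)]
      ring
  refine ⟨z, w, y, ?_, ?_, fun n => rfl, happ, ?_⟩
  · rw [hw0, smul_inv_smul₀ (hne 0)]; abel
  · intro n
    rw [hy, smul_inv_smul₀ (hne (n + 1))]; abel
  · intro n v
    rw [inner_sub_left, ← happ n, ← happ (n + 1), hy, map_smul, map_sub]
    simp [hne (n + 1)]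

variable {j : V →L[ℝ] H} {B : V →L[ℝ] V →L[ℝ] ℝ} {h : ℕ → ℝ} {φ : H} {z : ℕ → V} {w : ℕ → H}
  {y : ℕ → V}

/-- The coefficient of `‖A^(3/2) z‖²` in the smoothing estimate for a resolvent chain. -/
def cubicCoeff (h : ℕ → ℝ) : ℕ → ℝ
  | 0 => 0
  | n + 1 => cubicCoeff h n +
      2 * (∑ i ∈ Finset.range (n + 1), h i) * h (n + 1) * (∑ i ∈ Finset.range (n + 2), h i)

theorem cubicCoeff_nonneg (hh : ∀ n, 0 < h n) (n : ℕ) : 0 ≤ cubicCoeff h n := by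
  induction n with
  | zero => exact le_rfl
  | succ n ih =>
    have h1 := Finset.sum_nonneg (s := Finset.range (n + 1)) (fun i _ => (hh i).le)
    have h2 := Finset.sum_nonneg (s := Finset.range (n + 2)) (fun i _ => (hh i).le)
    have h3 := hh (n + 1)
    rw [cubicCoeff]
    positivity

/-- With `s` the elapsed time and `k` the next step, `(s + k)³ = s³ + 3 s k (s + k) + k³`, and `k ≤
κ s` bounds `k³` by `κ s k (s + k)`. The increment of the coefficient therefore dominates that of
the cube. The square of `3 + κ` is needed only in the base case, where `(h 0 + h 1)²` is compared
with `h 0 * h 1`. -/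
theorem le_cubicCoeff (hh : ∀ n, 0 < h n) {κ : ℝ} (hκ : 0 < κ) (h1 : ∀ n, h n ≤ κ * h (n + 1))
    (h2 : ∀ n, h (n + 1) ≤ κ * h n) (n : ℕ) :
    2 / (3 + κ) ^ 2 * (∑ i ∈ Finset.range (n + 2), h i) ^ 3 ≤ cubicCoeff h (n + 1) := by
  induction n with
  | zero =>
    simp only [cubicCoeff, Finset.sum_range_succ, Finset.sum_range_zero, zero_add]
    have a0 := hh 0
    have a1 := hh 1
    have b1 := h1 0
    have b2 := h2 0
    simp only [zero_add] at b1 b2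
    rw [div_mul_eq_mul_div, div_le_iff₀ (by positivity)]
    have e1 : h 0 + h 1 ≤ (1 + κ) * h 1 := by linarith
    have e2 : h 0 + h 1 ≤ (1 + κ) * h 0 := by linarith
    have e3 : (h 0 + h 1) * (h 0 + h 1) ≤ ((1 + κ) * h 1) * ((1 + κ) * h 0) := by gcongr
    have e4 : (h 0 + h 1) * (h 0 + h 1) ≤ h 0 * h 1 * (3 + κ) ^ 2 := by
      refine e3.trans ?_
      have : (1 + κ) ^ 2 ≤ (3 + κ) ^ 2 := by gcongr; norm_num
      have h01 : 0 ≤ h 0 * h 1 := by positivity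
      nlinarith
    have := mul_le_mul_of_nonneg_right e4 (by positivity : 0 ≤ 2 * (h 0 + h 1))
    linarith
  | succ n ih =>
    rw [cubicCoeff]
    set s := ∑ i ∈ Finset.range (n + 2), h i with hs
    have e0 : (∑ i ∈ Finset.range (n + 1 + 2), h i) = s + h (n + 2) := Finset.sum_range_succ _ _
    rw [e0]
    have a2 := hh (n + 2)
    have hsn : h (n + 1) ≤ s :=
      Finset.single_le_sum (f := h) (fun i _ => (hh i).le) (by simp)
    have a1 := hh (n + 1)
    have hk : h (n + 2) ≤ κ * s := (h2 (n + 1)).trans (by gcongr)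
    set k := h (n + 2)
    have hs0 : 0 < s := a1.trans_le hsn
    have hθ : 2 / (3 + κ) ^ 2 * (3 + κ) ≤ 2 := by
      rw [div_mul_eq_mul_div, div_le_iff₀ (by positivity)]
      nlinarith
    have key : (s + k) ^ 3 ≤ s ^ 3 + (3 + κ) * (s * k * (s + k)) := by
      have : k * k * k ≤ κ * s * k * (s + k) := by
        calc k * k * k = k * (k * k) := by ring
          _ ≤ κ * s * (k * (s + k)) := by gcongr; linarith
          _ = _ := by ring
      nlinarith
    calc 2 / (3 + κ) ^ 2 * (s + k) ^ 3
        ≤ 2 / (3 + κ) ^ 2 * (s ^ 3 + (3 + κ) * (s * k * (s + k))) := by gcongr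
      _ = 2 / (3 + κ) ^ 2 * s ^ 3 + (2 / (3 + κ) ^ 2 * (3 + κ)) * (s * k * (s + k)) := by ring
      _ ≤ cubicCoeff h (n + 1) + 2 * (s * k * (s + k)) := by gcongr
      _ = _ := by ring

/-- The left side is a Lyapunov functional, nonincreasing in `n`. Expanding `z n = z (n+1) + h y` in
the first two terms and using the decay of `‖w n‖²` in the third produces `B (y, y)` with
coefficient `2 s h (s + h)`, exactly the increment of `cubicCoeff`. -/
theorem IsResolventChain.energy (hc : IsResolventChain j B h φ z w y) (hB0 : ∀ v, 0 ≤ B v v)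
    (hsymm : ∀ u v, B u v = B v u) (hh : ∀ n, 0 < h n) (n : ℕ) :
    ‖j (z n)‖ ^ 2 + 2 * (∑ i ∈ Finset.range (n + 1), h i) * B (z n) (z n)
      + (∑ i ∈ Finset.range (n + 1), h i) ^ 2 * ‖w n‖ ^ 2
      + cubicCoeff h n * B (y n) (y n) ≤ ‖φ‖ ^ 2 := by
  induction n with
  | zero =>
    rw [hc.start, norm_add_sq_real, real_inner_smul_right, norm_smul, hc.apply_z,
      real_inner_comm (j (z 0)) (w 0)]
    simp only [cubicCoeff, zero_add, Finset.sum_range_one, Real.norm_eq_abs, mul_pow, sq_abs]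
    linarith
  | succ n ih =>
    refine le_trans ?_ ih
    set s := ∑ i ∈ Finset.range (n + 1), h i with hs
    have e0 : (∑ i ∈ Finset.range (n + 1 + 1), h i) = s + h (n + 1) := Finset.sum_range_succ _ _
    have e3 : cubicCoeff h (n + 1) = cubicCoeff h n + 2 * s * h (n + 1) * (s + h (n + 1)) := by
      rw [cubicCoeff, e0]
    rw [e0, e3]
    have hs0 : 0 ≤ s := Finset.sum_nonneg (fun i _ => (hh i).le)
    have hk := hh (n + 1)
    have E0 : ‖j (z n)‖ ^ 2 = ‖j (z (n + 1))‖ ^ 2 + 2 * h (n + 1) * B (z (n + 1)) (z (n + 1))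
        + h (n + 1) ^ 2 * ‖w (n + 1)‖ ^ 2 := by
      rw [hc.next n, map_add, map_smul, hc.lift, norm_add_sq_real, real_inner_smul_right, norm_smul,
        hc.apply_z, real_inner_comm (j (z (n + 1)))]
      simp only [Real.norm_eq_abs, mul_pow, sq_abs]
      ring
    have E1 : B (z n) (z n) = B (z (n + 1)) (z (n + 1)) + 2 * h (n + 1) * ‖w (n + 1)‖ ^ 2
        + h (n + 1) ^ 2 * B (y (n + 1)) (y (n + 1)) := by
      have : B (z (n + 1)) (y (n + 1)) = ‖w (n + 1)‖ ^ 2 := by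
        rw [hc.apply_z, hc.lift, real_inner_self_eq_norm_sq]
      rw [hc.next n]
      simp only [map_add, map_smul, add_apply, smul_apply,
        smul_eq_mul, hsymm (y (n + 1)) (z (n + 1)), this]
      ring
    have E2 : ‖w (n + 1)‖ ^ 2 + 2 * (h (n + 1) * B (y (n + 1)) (y (n + 1))) ≤ ‖w n‖ ^ 2 := by
      have e : w n = w (n + 1) + (w n - w (n + 1)) := by abel
      rw [hc.apply_y, hc.lift, e, norm_add_sq_real, add_sub_cancel_left, real_inner_comm]
      nlinarith [sq_nonneg ‖w n - w (n + 1)‖]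
    -- `B (y n) (y n)` decreases along the chain: with `q` the difference of consecutive `y`, the
    -- form of the later one against `q` is `‖j q‖² / h`. At `n = 0` the coefficient vanishes, so
    -- the unspecified `y 0` does not enter.
    have E3 : cubicCoeff h n * B (y (n + 1)) (y (n + 1)) ≤ cubicCoeff h n * B (y n) (y n) := by
      cases n with
      | zero => simp [cubicCoeff]
      | succ n =>
        refine mul_le_mul_of_nonneg_left ?_ (cubicCoeff_nonneg hh _)
        obtain ⟨q, hq⟩ : ∃ q, y (n + 1) = y (n + 2) + q := ⟨y (n + 1) - y (n + 2), by abel⟩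
        have h5 : 0 ≤ B (y (n + 2)) q := by
          have := hc.apply_y (n + 1) q
          rw [← hc.lift, ← hc.lift, ← map_sub, hq, add_sub_cancel_left,
            real_inner_self_eq_norm_sq] at this
          by_contra hneg
          push Not at hneg
          nlinarith [sq_nonneg ‖j q‖, mul_neg_of_pos_of_neg (hh (n + 1 + 1)) hneg]
        rw [hq]
        simp only [map_add, add_apply]
        have h6 := hsymm q (y (n + 2))
        have h7 := hB0 q
        show B (y (n + 2)) (y (n + 2)) ≤ _
        linarith
    have hy0 := hB0 (y (n + 1))
    set k := h (n + 1)
    set N1 := B (z (n + 1)) (z (n + 1))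
    set N2 := ‖w (n + 1)‖ ^ 2
    set N3 := B (y (n + 1)) (y (n + 1))
    have hN2 : 0 ≤ N2 := sq_nonneg _
    have E2' : s ^ 2 * (N2 + 2 * (k * N3)) ≤ s ^ 2 * ‖w n‖ ^ 2 := by gcongr
    have hp : 0 ≤ 2 * s * k * N2 := by positivity
    rw [E0, E1]
    linarith

theorem IsResolventChain.norm_w_le (hc : IsResolventChain j B h φ z w y) (hB0 : ∀ v, 0 ≤ B v v)
    (hsymm : ∀ u v, B u v = B v u) (hh : ∀ n, 0 < h n) (n : ℕ) :
    (∑ i ∈ Finset.range (n + 1), h i) * ‖w n‖ ≤ ‖φ‖ := by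
  have := hc.energy hB0 hsymm hh n
  have hs0 : 0 ≤ ∑ i ∈ Finset.range (n + 1), h i := Finset.sum_nonneg (fun i _ => (hh i).le)
  have h1 := mul_nonneg (mul_nonneg zero_le_two hs0) (hB0 (z n))
  have h2 := mul_nonneg (cubicCoeff_nonneg hh n) (hB0 (y n))
  refine le_of_sq_le_sq ?_ (norm_nonneg _)
  rw [mul_pow]
  nlinarith [sq_nonneg ‖j (z n)‖]

/-- `B (y, y)` plays the role of `‖A^(3/2) z‖²`, hence the third power of the elapsed time. -/
theorem IsResolventChain.form_y_le (hc : IsResolventChain j B h φ z w y) (hB0 : ∀ v, 0 ≤ B v v)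
    (hsymm : ∀ u v, B u v = B v u) (hh : ∀ n, 0 < h n) {κ : ℝ} (hκ : 0 < κ)
    (h1 : ∀ n, h n ≤ κ * h (n + 1)) (h2 : ∀ n, h (n + 1) ≤ κ * h n) (n : ℕ) :
    (∑ i ∈ Finset.range (n + 2), h i) ^ 3 * B (y (n + 1)) (y (n + 1))
      ≤ ((3 + κ) * ‖φ‖) ^ 2 := by
  have he := hc.energy hB0 hsymm hh (n + 1)
  have hs0 : 0 ≤ ∑ i ∈ Finset.range (n + 1 + 1), h i := Finset.sum_nonneg (fun i _ => (hh i).le)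
  have h3 := mul_nonneg (mul_nonneg zero_le_two hs0) (hB0 (z (n + 1)))
  have h4 := mul_le_mul_of_nonneg_right (le_cubicCoeff hh hκ h1 h2 n) (hB0 (y (n + 1)))
  rw [div_mul_eq_mul_div, div_mul_eq_mul_div, div_le_iff₀ (by positivity)] at h4
  have h5 : cubicCoeff h (n + 1) * B (y (n + 1)) (y (n + 1)) ≤ ‖φ‖ ^ 2 := by
    have : 0 ≤ (∑ i ∈ Finset.range (n + 1 + 1), h i) ^ 2 * ‖w (n + 1)‖ ^ 2 := by positivity
    nlinarith [sq_nonneg ‖j (z (n + 1))‖]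
  have h6 := mul_le_mul_of_nonneg_right h5 (sq_nonneg (3 + κ))
  have h7 : 0 ≤ ‖φ‖ ^ 2 * (3 + κ) ^ 2 := by positivity
  rw [mul_pow]
  nlinarith

end Resolvent

/-! ### Duality for the scheme with time-dependent operators -/

section Evolution

variable {V H : Type*} [NormedAddCommGroup V] [InnerProductSpace ℝ V]
  [NormedAddCommGroup H] [InnerProductSpace ℝ H]

/-- The implicit Euler scheme `(U (i+1) - U i) / k i + A i (v i) = f i` with `U 0 = 0`, where
`v i` is `U (i+1)` as an element of `V`, `A i` is the operator of the form `B i`, `g i = A i (v i)`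
and `k i = t (i+1) - t i`. -/
structure IsEulerScheme (J : V →L[ℝ] H) (B : ℕ → V →L[ℝ] V →L[ℝ] ℝ) (M : ℕ) (t : ℕ → ℝ)
    (v : ℕ → V) (U f g : ℕ → H) : Prop where
  start : U 0 = 0
  lift : ∀ i < M, U (i + 1) = J (v i)
  step : ∀ i < M, U (i + 1) + (t (i + 1) - t i) • g i = U i + (t (i + 1) - t i) • f i
  apply : ∀ i < M, ∀ w, B i (v i) w = inner ℝ (g i) (J w)

variable {J : V →L[ℝ] H} {B : ℕ → V →L[ℝ] V →L[ℝ] ℝ} {M : ℕ} {t : ℕ → ℝ}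
  {v : ℕ → V} {U f g : ℕ → H}

/-- Test each step with `U (n+1)`: the operator term is nonnegative and can be dropped. -/
theorem IsEulerScheme.norm_le (hs : IsEulerScheme J B M t v U f g)
    (hB0 : ∀ i < M, ∀ w, 0 ≤ B i w w) (ht : ∀ i < M, t i < t (i + 1)) (n : ℕ) (hn : n ≤ M) :
    ‖U n‖ ≤ ∑ i ∈ Finset.range n, (t (i + 1) - t i) * ‖f i‖ := by
  induction n with
  | zero => simp [hs.start]
  | succ n ih =>
    rw [Finset.sum_range_succ]
    refine le_trans ?_ (add_le_add_left (ih (by omega)) _)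
    have hk : 0 ≤ t (n + 1) - t n := sub_nonneg.2 (ht n hn).le
    have h1 := congrArg (fun x => inner ℝ x (U (n + 1))) (hs.step n hn)
    simp only [inner_add_left, real_inner_smul_left, real_inner_self_eq_norm_sq] at h1
    have h2 : 0 ≤ inner ℝ (g n) (U (n + 1)) := by
      rw [hs.lift n hn, ← hs.apply n hn]
      exact hB0 n hn _
    have h3 := real_inner_le_norm (U n) (U (n + 1))
    have h4 := mul_le_mul_of_nonneg_left (real_inner_le_norm (f n) (U (n + 1))) hk
    have h5 := mul_nonneg hk h2
    by_contra hcon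
    push Not at hcon
    have h6 : 0 ≤ ‖U n‖ + (t (n + 1) - t n) * ‖f n‖ := by positivity
    have h7 : 0 < ‖U (n + 1)‖ := h6.trans_lt hcon
    nlinarith

/-- Discrete Duhamel formula. Moving back one step replaces `w n` by `w (n+1)` at the price of `B m
(v l) y`, while the scheme produces `B l (v l) y`; only their difference survives. At `n = m` the
boundary term vanishes because `U 0 = 0`. -/
theorem IsEulerScheme.inner_eq (hs : IsEulerScheme J B M t v U f g) {m : ℕ} (hm : m < M)
    (hsymm : ∀ u w, B m u w = B m w u) {φ : H} {z : ℕ → V} {w : ℕ → H} {y : ℕ → V}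
    (hc : IsResolventChain J (B m) (fun i => t (m - i + 1) - t (m - i)) φ z w y)
    (n : ℕ) (hn : n ≤ m) :
    inner ℝ (g m) φ = inner ℝ (U (m - n)) (w n)
      + ∑ i ∈ Finset.range (n + 1), (t (m - i + 1) - t (m - i)) * inner ℝ (f (m - i)) (w i)
      + ∑ i ∈ Finset.range n, (t (m - (i + 1) + 1) - t (m - (i + 1))) *
          (B m (v (m - (i + 1))) (y (i + 1)) - B (m - (i + 1)) (v (m - (i + 1))) (y (i + 1))) := by
  induction n with
  | zero =>
    have h1 := congrArg (fun x => inner ℝ x (w 0)) (hs.step m hm)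
    simp only [inner_add_left, real_inner_smul_left] at h1
    have h2 : inner ℝ (g m) (J (z 0)) = inner ℝ (U (m + 1)) (w 0) := by
      rw [← hs.apply m hm, hsymm, hc.apply_z, hs.lift m hm, real_inner_comm]
    conv_lhs => rw [hc.start]
    simp only [tsub_zero, inner_add_right, real_inner_smul_right, zero_add, Finset.sum_range_one,
      Finset.range_zero, Finset.sum_empty, add_zero]
    linarith
  | succ n ih =>
    rw [ih (by omega)]
    simp only [Finset.sum_range_succ]
    obtain ⟨l, rfl⟩ : ∃ l, m = l + (n + 1) := ⟨m - (n + 1), by omega⟩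
    have e1 : l + (n + 1) - n = l + 1 := by omega
    have e2 : l + (n + 1) - (n + 1) = l := by omega
    have hl : l < M := by omega
    have hy := hc.apply_y n (v l)
    have h1 := congrArg (fun x => inner ℝ x (w (n + 1))) (hs.step l hl)
    simp only [inner_add_left, real_inner_smul_left] at h1
    have h2 : B l (v l) (y (n + 1)) = inner ℝ (g l) (w (n + 1)) := by
      rw [hs.apply l hl, hc.lift]
    simp only [e2] at hy ⊢
    rw [e1, h2, hsymm (v l)]
    rw [← hs.lift l hl, inner_sub_left, real_inner_comm (U (l + 1)) (w n),
      real_inner_comm (U (l + 1)) (w (n + 1))] at hy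
    linarith

theorem sum_reversed_steps (t : ℕ → ℝ) (m n : ℕ) (hn : n ≤ m) :
    ∑ i ∈ Finset.range (n + 1), (t (m - i + 1) - t (m - i)) = t (m + 1) - t (m - n) := by
  induction n with
  | zero => simp
  | succ n ih =>
    rw [Finset.sum_range_succ, ih (by omega), show m - (n + 1) + 1 = m - n by omega]
    ring

theorem IsEulerScheme.norm_operator_le [CompleteSpace V] (hs : IsEulerScheme J B M t v U f g)
    (hB0 : ∀ i < M, ∀ w, 0 ≤ B i w w) (hsymm : ∀ i < M, ∀ u w, B i u w = B i w u)
    {c : ℝ} (hc : 0 < c) (hcoer : ∀ i < M, ∀ w, c * ‖w‖ ^ 2 ≤ ‖J w‖ ^ 2 + B i w w)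
    (ht : ∀ i < M, t i < t (i + 1)) {κ : ℝ} (hκ : 1 ≤ κ)
    (hr1 : ∀ i, i + 1 < M → t (i + 1) - t i ≤ κ * (t (i + 2) - t (i + 1)))
    (hr2 : ∀ i, i + 1 < M → t (i + 2) - t (i + 1) ≤ κ * (t (i + 1) - t i))
    {m : ℕ} (hm : m < M) (D : ℕ → ℝ) (hD : ∀ l < m, 0 ≤ D l)
    (hdiff : ∀ l < m, ∀ w, |B m (v l) w - B l (v l) w| ≤ D l * √(B m w w)) :
    ‖g m‖ ≤ ∑ l ∈ Finset.range (m + 1), (t (l + 1) - t l) * ((t (m + 1) - t l)⁻¹ * ‖f l‖)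
      + (3 + κ) * ∑ l ∈ Finset.range m,
          (t (l + 1) - t l) * (D l / (t (m + 1) - t l) ^ (3 / 2 : ℝ)) := by
  -- A chain has infinitely many steps. Truncated subtraction repeats the first mesh step for
  -- indices beyond `m`, which respects both ratio bounds because `1 ≤ κ`.
  set h : ℕ → ℝ := fun i => t (m - i + 1) - t (m - i) with hh
  have hpos : ∀ n, 0 < h n := fun n => sub_pos.2 (ht _ (by omega))
  have hκ0 : 0 < κ := one_pos.trans_le hκ
  have h1 : ∀ n, h n ≤ κ * h (n + 1) := by
    intro n
    rcases le_or_gt m n with hn | hn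
    · simp only [hh, show m - n = 0 by omega, show m - (n + 1) = 0 by omega]
      exact le_mul_of_one_le_left (sub_nonneg.2 (ht _ (by omega)).le) hκ
    · have := hr2 (m - (n + 1)) (by omega)
      simp only [hh, show m - n = m - (n + 1) + 1 by omega]
      exact this
  have h2 : ∀ n, h (n + 1) ≤ κ * h n := by
    intro n
    rcases le_or_gt m n with hn | hn
    · simp only [hh, show m - n = 0 by omega, show m - (n + 1) = 0 by omega]
      exact le_mul_of_one_le_left (sub_nonneg.2 (ht _ (by omega)).le) hκ
    · have := hr1 (m - (n + 1)) (by omega)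
      simp only [hh, show m - n = m - (n + 1) + 1 by omega]
      exact this
  obtain ⟨z, w, y, hch⟩ := exists_resolventChain J (B m) (hB0 m hm) hc (hcoer m hm) h hpos (g m)
  have hin := hs.inner_eq hm (hsymm m hm) hch m le_rfl
  rw [Nat.sub_self, hs.start, inner_zero_left, zero_add, real_inner_self_eq_norm_sq] at hin
  have htpos : ∀ l ≤ m, 0 < t (m + 1) - t l := by
    intro l hl
    obtain ⟨n, rfl⟩ : ∃ n, l = m - n := ⟨m - l, by omega⟩
    rw [show m - n = m - min n m by omega, ← sum_reversed_steps t m (min n m) (min_le_right _ _)]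
    exact Finset.sum_pos (fun i _ => hpos i) (by simp)
  have b1 : ∑ i ∈ Finset.range (m + 1), h i * inner ℝ (f (m - i)) (w i)
      ≤ ∑ i ∈ Finset.range (m + 1),
        (fun l => (t (l + 1) - t l) * ((t (m + 1) - t l)⁻¹ * ‖f l‖) * ‖g m‖) (m + 1 - 1 - i) := by
    refine Finset.sum_le_sum fun i hi => ?_
    have him : i ≤ m := by simpa [Nat.lt_succ_iff] using hi
    have hw := hch.norm_w_le (hB0 m hm) (hsymm m hm) hpos i
    rw [sum_reversed_steps t m i him] at hw
    have hp := htpos (m - i) (by omega)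
    have hw' : ‖w i‖ ≤ (t (m + 1) - t (m - i))⁻¹ * ‖g m‖ := by
      rw [inv_mul_eq_div, le_div_iff₀ hp]
      linarith
    calc h i * inner ℝ (f (m - i)) (w i) ≤ h i * (‖f (m - i)‖ * ‖w i‖) := by
          have := hpos i
          gcongr
          exact real_inner_le_norm _ _
      _ ≤ h i * (‖f (m - i)‖ * ((t (m + 1) - t (m - i))⁻¹ * ‖g m‖)) := by
          have := hpos i
          gcongr
      _ = _ := by
          simp only [hh, Nat.add_sub_cancel]
          ring
  rw [Finset.sum_range_reflect
    (fun l => (t (l + 1) - t l) * ((t (m + 1) - t l)⁻¹ * ‖f l‖) * ‖g m‖), ← Finset.sum_mul] at b1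
  have b2 : ∑ i ∈ Finset.range m, (t (m - (i + 1) + 1) - t (m - (i + 1))) *
          (B m (v (m - (i + 1))) (y (i + 1)) - B (m - (i + 1)) (v (m - (i + 1))) (y (i + 1)))
      ≤ ∑ i ∈ Finset.range m, (fun l => (t (l + 1) - t l) *
        (D l / (t (m + 1) - t l) ^ (3 / 2 : ℝ)) * ((3 + κ) * ‖g m‖)) (m - 1 - i) := by
    refine Finset.sum_le_sum fun i hi => ?_
    have him : i < m := by simpa using hi
    have hy := hch.form_y_le (hB0 m hm) (hsymm m hm) hpos hκ0 h1 h2 i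
    rw [sum_reversed_steps t m (i + 1) him] at hy
    rw [show m - 1 - i = m - (i + 1) by omega]
    have hlm : m - (i + 1) < m := by omega
    set l := m - (i + 1)
    have hp := htpos l hlm.le
    have hk : 0 ≤ t (l + 1) - t l := sub_nonneg.2 (ht l (by omega)).le
    have hsq : √(B m (y (i + 1)) (y (i + 1)))
        ≤ ((3 + κ) * ‖g m‖) / (t (m + 1) - t l) ^ (3 / 2 : ℝ) := by
      rw [le_div_iff₀ (by positivity), ← Real.sqrt_sq (Real.rpow_nonneg hp.le (3 / 2 : ℝ)),
        ← Real.sqrt_mul (hB0 m hm _), ← Real.rpow_natCast, ← Real.rpow_mul hp.le]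
      rw [Real.sqrt_le_left (by positivity)]
      norm_num
      linarith
    calc (t (l + 1) - t l) * (B m (v l) (y (i + 1)) - B l (v l) (y (i + 1)))
        ≤ (t (l + 1) - t l) * (D l * √(B m (y (i + 1)) (y (i + 1)))) := by
          gcongr
          exact (le_abs_self _).trans (hdiff l hlm _)
      _ ≤ (t (l + 1) - t l) *
          (D l * (((3 + κ) * ‖g m‖) / (t (m + 1) - t l) ^ (3 / 2 : ℝ))) := by
          have := hD l hlm
          gcongr
      _ = _ := by ring
  rw [Finset.sum_range_reflect (fun l => (t (l + 1) - t l) *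
    (D l / (t (m + 1) - t l) ^ (3 / 2 : ℝ)) * ((3 + κ) * ‖g m‖)), ← Finset.sum_mul] at b2
  have hfin : ‖g m‖ * ‖g m‖ ≤ (∑ l ∈ Finset.range (m + 1),
      (t (l + 1) - t l) * ((t (m + 1) - t l)⁻¹ * ‖f l‖)
      + (3 + κ) * ∑ l ∈ Finset.range m,
          (t (l + 1) - t l) * (D l / (t (m + 1) - t l) ^ (3 / 2 : ℝ))) * ‖g m‖ := by
    rw [← sq, hin]
    refine (add_le_add b1 b2).trans (le_of_eq ?_)
    ring
  rcases (norm_nonneg (g m)).eq_or_lt with h0 | h0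
  · rw [← h0]
    refine add_nonneg (Finset.sum_nonneg fun l hl => ?_)
      (mul_nonneg (by positivity) (Finset.sum_nonneg fun l hl => ?_))
    · have hl' : l ≤ m := by simpa [Nat.lt_succ_iff] using hl
      have := htpos l hl'
      have hk : 0 ≤ t (l + 1) - t l := sub_nonneg.2 (ht l (by omega)).le
      positivity
    · have hl' : l < m := by simpa using hl
      have := htpos l hl'.le
      have hk : 0 ≤ t (l + 1) - t l := sub_nonneg.2 (ht l (by omega)).le
      have := hD l hl'
      positivity
  · exact le_of_mul_le_mul_right hfin h0

end Evolution

/-! ### Weighted `ℓ^p` norms and Schur's test -/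

section Sequences

/-- The norm of `ℓ^p` with weights `k`, for the entries with index `< M`. -/
noncomputable def seqNorm (p : ℝ) (k : ℕ → ℝ) (M : ℕ) (x : ℕ → ℝ) : ℝ :=
  (∑ i ∈ Finset.range M, k i * x i ^ p) ^ (1 / p)

variable {p : ℝ} {k : ℕ → ℝ} {M : ℕ}

theorem seqNorm_nonneg (hk : ∀ i < M, 0 ≤ k i) {x : ℕ → ℝ} (hx : ∀ i < M, 0 ≤ x i) :
    0 ≤ seqNorm p k M x := by
  refine Real.rpow_nonneg (Finset.sum_nonneg fun i hi => ?_) _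
  have hi := Finset.mem_range.1 hi
  exact mul_nonneg (hk i hi) (Real.rpow_nonneg (hx i hi) _)

theorem seqNorm_mono (hp : 1 ≤ p) (hk : ∀ i < M, 0 ≤ k i) {x y : ℕ → ℝ} (hx : ∀ i < M, 0 ≤ x i)
    (hxy : ∀ i < M, x i ≤ y i) : seqNorm p k M x ≤ seqNorm p k M y := by
  refine Real.rpow_le_rpow (Finset.sum_nonneg fun i hi => ?_) (Finset.sum_le_sum fun i hi => ?_)
    (by positivity)
  · have hi := Finset.mem_range.1 hi
    exact mul_nonneg (hk i hi) (Real.rpow_nonneg (hx i hi) _)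
  · have hi := Finset.mem_range.1 hi
    have := hk i hi
    have := hx i hi
    have := hxy i hi
    gcongr

theorem seqNorm_add_le (hp : 1 ≤ p) (hk : ∀ i < M, 0 ≤ k i) {x y : ℕ → ℝ}
    (hx : ∀ i < M, 0 ≤ x i) (hy : ∀ i < M, 0 ≤ y i) :
    seqNorm p k M (fun i => x i + y i) ≤ seqNorm p k M x + seqNorm p k M y := by
  have hp0 : p ≠ 0 := by positivity
  have key : ∀ z : ℕ → ℝ, (∀ i < M, 0 ≤ z i) →
      seqNorm p k M z = (∑ i ∈ Finset.range M, (k i ^ (1 / p) * z i) ^ p) ^ (1 / p) := by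
    intro z hz
    unfold seqNorm
    congr 1
    refine Finset.sum_congr rfl fun i hi => ?_
    have hi := Finset.mem_range.1 hi
    rw [Real.mul_rpow (Real.rpow_nonneg (hk i hi) _) (hz i hi), ← Real.rpow_mul (hk i hi),
      one_div_mul_cancel hp0, Real.rpow_one]
  rw [key _ (fun i hi => add_nonneg (hx i hi) (hy i hi)), key x hx, key y hy]
  simp only [mul_add]
  exact Real.Lp_add_le_of_nonneg _ hp
    (fun i hi => mul_nonneg (Real.rpow_nonneg (hk i (Finset.mem_range.1 hi)) _)
      (hx i (Finset.mem_range.1 hi)))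
    (fun i hi => mul_nonneg (Real.rpow_nonneg (hk i (Finset.mem_range.1 hi)) _)
      (hy i (Finset.mem_range.1 hi)))

theorem seqNorm_const_mul (hp : 1 ≤ p) (hk : ∀ i < M, 0 ≤ k i) {x : ℕ → ℝ}
    (hx : ∀ i < M, 0 ≤ x i) {c : ℝ} (hc : 0 ≤ c) :
    seqNorm p k M (fun i => c * x i) = c * seqNorm p k M x := by
  have hp0 : p ≠ 0 := by positivity
  have hsum : ∑ i ∈ Finset.range M, k i * (c * x i) ^ p
      = c ^ p * ∑ i ∈ Finset.range M, k i * x i ^ p := by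
    rw [Finset.mul_sum]
    refine Finset.sum_congr rfl fun i hi => ?_
    rw [Real.mul_rpow hc (hx i (Finset.mem_range.1 hi))]
    ring
  unfold seqNorm
  rw [hsum, Real.mul_rpow (by positivity), ← Real.rpow_mul hc, mul_one_div_cancel hp0,
    Real.rpow_one]
  exact Finset.sum_nonneg fun i hi => mul_nonneg (hk i (Finset.mem_range.1 hi))
    (Real.rpow_nonneg (hx i (Finset.mem_range.1 hi)) _)

/-- **Schur's test** for a nonnegative kernel on a weighted finite `ℓ^p` space. -/
theorem seqNorm_kernel_le (hp : 1 ≤ p) (hk : ∀ i < M, 0 ≤ k i) {K : ℕ → ℕ → ℝ}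
    (hK : ∀ m < M, ∀ l < M, 0 ≤ K m l) {A : ℝ} (hA : 0 ≤ A)
    (hrow : ∀ m < M, ∑ l ∈ Finset.range M, k l * K m l ≤ A)
    (hcol : ∀ l < M, ∑ m ∈ Finset.range M, k m * K m l ≤ A)
    {x : ℕ → ℝ} (hx : ∀ i < M, 0 ≤ x i) :
    seqNorm p k M (fun m => ∑ l ∈ Finset.range M, k l * (K m l * x l)) ≤ A * seqNorm p k M x := by
  have hp0 : 0 < p := by positivity
  -- Hölder with weights `k l * K m l`, whose total mass is at most `A`. The truncations by `if`
  -- supply nonnegativity at every index.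
  have hpt : ∀ m < M, (∑ l ∈ Finset.range M, k l * (K m l * x l)) ^ p
      ≤ A ^ (p - 1) * ∑ l ∈ Finset.range M, k l * K m l * x l ^ p := by
    intro m hm
    have h1 := Real.inner_le_weight_mul_Lp_of_nonneg (Finset.range M) hp
      (fun l => if l < M then k l * K m l else 0) (fun l => if l < M then x l else 0)
      (fun l => by
        split_ifs with h
        · exact mul_nonneg (hk l h) (hK m hm l h)
        · exact le_rfl)
      (fun l => by
        split_ifs with h
        · exact hx l h
        · exact le_rfl)
    have e1 : ∑ l ∈ Finset.range M, (if l < M then k l * K m l else 0) * (if l < M then x l else 0)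
        = ∑ l ∈ Finset.range M, k l * (K m l * x l) := Finset.sum_congr rfl fun l hl => by
      rw [if_pos (Finset.mem_range.1 hl), if_pos (Finset.mem_range.1 hl)]; ring
    have e2 : ∑ l ∈ Finset.range M, (if l < M then k l * K m l else 0)
        = ∑ l ∈ Finset.range M, k l * K m l := Finset.sum_congr rfl fun l hl => by
      rw [if_pos (Finset.mem_range.1 hl)]
    have e3 : ∑ l ∈ Finset.range M, (if l < M then k l * K m l else 0) *
          (if l < M then x l else 0) ^ p
        = ∑ l ∈ Finset.range M, k l * K m l * x l ^ p := Finset.sum_congr rfl fun l hl => by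
      rw [if_pos (Finset.mem_range.1 hl), if_pos (Finset.mem_range.1 hl)]
    rw [e1, e2, e3] at h1
    have hs1 : 0 ≤ ∑ l ∈ Finset.range M, k l * K m l := Finset.sum_nonneg fun l hl =>
      mul_nonneg (hk l (Finset.mem_range.1 hl)) (hK m hm l (Finset.mem_range.1 hl))
    have hs2 : 0 ≤ ∑ l ∈ Finset.range M, k l * K m l * x l ^ p := Finset.sum_nonneg fun l hl =>
      mul_nonneg (mul_nonneg (hk l (Finset.mem_range.1 hl)) (hK m hm l (Finset.mem_range.1 hl)))
        (Real.rpow_nonneg (hx l (Finset.mem_range.1 hl)) _)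
    have hs3 : 0 ≤ ∑ l ∈ Finset.range M, k l * (K m l * x l) := Finset.sum_nonneg fun l hl =>
      mul_nonneg (hk l (Finset.mem_range.1 hl)) (mul_nonneg (hK m hm l (Finset.mem_range.1 hl))
        (hx l (Finset.mem_range.1 hl)))
    have hpinv : 0 ≤ 1 - p⁻¹ := sub_nonneg.2 (inv_le_one_of_one_le₀ hp)
    calc (∑ l ∈ Finset.range M, k l * (K m l * x l)) ^ p
        ≤ ((∑ l ∈ Finset.range M, k l * K m l) ^ (1 - p⁻¹) *
            (∑ l ∈ Finset.range M, k l * K m l * x l ^ p) ^ p⁻¹) ^ p := by gcongr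
      _ ≤ (A ^ (1 - p⁻¹) * (∑ l ∈ Finset.range M, k l * K m l * x l ^ p) ^ p⁻¹) ^ p := by
          gcongr
          exact hrow m hm
      _ = _ := by
          rw [Real.mul_rpow (by positivity) (by positivity), ← Real.rpow_mul hA,
            ← Real.rpow_mul hs2, inv_mul_cancel₀ hp0.ne', Real.rpow_one, sub_mul,
            inv_mul_cancel₀ hp0.ne', one_mul]
  have hsum : ∑ m ∈ Finset.range M, k m * (∑ l ∈ Finset.range M, k l * (K m l * x l)) ^ p
      ≤ A ^ p * ∑ l ∈ Finset.range M, k l * x l ^ p := by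
    calc ∑ m ∈ Finset.range M, k m * (∑ l ∈ Finset.range M, k l * (K m l * x l)) ^ p
        ≤ ∑ m ∈ Finset.range M, k m *
            (A ^ (p - 1) * ∑ l ∈ Finset.range M, k l * K m l * x l ^ p) := by
          refine Finset.sum_le_sum fun m hm => ?_
          have hm := Finset.mem_range.1 hm
          exact mul_le_mul_of_nonneg_left (hpt m hm) (hk m hm)
      _ = A ^ (p - 1) * ∑ l ∈ Finset.range M, k l * x l ^ p *
            ∑ m ∈ Finset.range M, k m * K m l := by
          simp only [Finset.mul_sum]
          rw [Finset.sum_comm]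
          refine Finset.sum_congr rfl fun l _ => Finset.sum_congr rfl fun m _ => ?_
          ring
      _ ≤ A ^ (p - 1) * ∑ l ∈ Finset.range M, k l * x l ^ p * A := by
          gcongr with l hl
          · have hl := Finset.mem_range.1 hl
            exact mul_nonneg (hk l hl) (Real.rpow_nonneg (hx l hl) _)
          · exact hcol l (Finset.mem_range.1 hl)
      _ = A ^ (p - 1) * A * ∑ l ∈ Finset.range M, k l * x l ^ p := by
          rw [← Finset.sum_mul]; ring
      _ = _ := by
          congr 1
          rcases hA.eq_or_lt with h0 | h0
          · rw [← h0, mul_zero, Real.zero_rpow hp0.ne']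
          · rw [← Real.rpow_add_one h0.ne', sub_add_cancel]
  have hs : 0 ≤ ∑ l ∈ Finset.range M, k l * x l ^ p := Finset.sum_nonneg fun l hl =>
    mul_nonneg (hk l (Finset.mem_range.1 hl)) (Real.rpow_nonneg (hx l (Finset.mem_range.1 hl)) _)
  unfold seqNorm
  calc _ ≤ (A ^ p * ∑ l ∈ Finset.range M, k l * x l ^ p) ^ (1 / p) := by
        refine Real.rpow_le_rpow (Finset.sum_nonneg fun m hm => ?_) hsum (by positivity)
        have hm := Finset.mem_range.1 hm
        refine mul_nonneg (hk m hm) (Real.rpow_nonneg (Finset.sum_nonneg fun l hl => ?_) _)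
        have hl := Finset.mem_range.1 hl
        exact mul_nonneg (hk l hl) (mul_nonneg (hK m hm l hl) (hx l hl))
    _ = _ := by
        rw [Real.mul_rpow (by positivity) hs, ← Real.rpow_mul hA, mul_one_div_cancel hp0.ne',
          Real.rpow_one]

/-- An upper Riemann sum with right endpoints of a nonincreasing function is at most its
integral. -/
theorem sum_antitone_le_integral {T : ℝ} {G : ℝ → ℝ} (hG : AntitoneOn G (Ioc 0 T))
    (hG0 : ∀ s ∈ Ioc 0 T, 0 ≤ G s) (hGi : IntegrableOn G (Ioc 0 T)) (τ : ℕ → ℝ) (n : ℕ)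
    (h0 : τ 0 = 0) (hτ : ∀ i < n, τ i < τ (i + 1)) (hn : τ n ≤ T) :
    ∑ i ∈ Finset.range n, (τ (i + 1) - τ i) * G (τ (i + 1)) ≤ ∫ s in Ioc 0 T, G s := by
  have hmono : ∀ i ≤ n, ∀ l ≤ i, τ l ≤ τ i := by
    intro i hi
    induction i with
    | zero => intro l hl; rw [Nat.le_zero.1 hl]
    | succ i ih =>
      intro l hl
      rcases Nat.lt_or_eq_of_le hl with h | h
      · exact (ih (by omega) l (by omega)).trans (hτ i (by omega)).le
      · rw [h]
  have hint : ∀ i ≤ n, IntegrableOn G (Ioc 0 (τ i)) := fun i hi =>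
    hGi.mono_set (Ioc_subset_Ioc_right ((hmono n le_rfl i hi).trans hn))
  have key : ∀ i ≤ n, ∑ l ∈ Finset.range i, (τ (l + 1) - τ l) * G (τ (l + 1))
      ≤ ∫ s in Ioc 0 (τ i), G s := by
    intro i hi
    induction i with
    | zero => simp [h0]
    | succ i ih =>
      have hi0 : 0 ≤ τ i := h0 ▸ hmono i (by omega) 0 (by omega)
      have hlt := hτ i (by omega)
      have hT := (hmono n le_rfl (i + 1) hi).trans hn
      rw [Finset.sum_range_succ, ← Ioc_union_Ioc_eq_Ioc hi0 hlt.le,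
        setIntegral_union (Ioc_disjoint_Ioc_of_le le_rfl) measurableSet_Ioc (hint i (by omega))
          ((hint (i + 1) hi).mono_set (Ioc_subset_Ioc_left hi0))]
      refine add_le_add (ih (by omega)) ?_
      have hc : ∫ _ in Ioc (τ i) (τ (i + 1)), G (τ (i + 1)) = (τ (i + 1) - τ i) * G (τ (i + 1)) := by
        simp [hlt.le]
      rw [← hc]
      refine setIntegral_mono_on (by simp)
        ((hint (i + 1) hi).mono_set (Ioc_subset_Ioc_left hi0)) measurableSet_Ioc fun s hs => ?_
      exact hG ⟨hi0.trans_lt hs.1, hs.2.trans hT⟩ ⟨hi0.trans_lt hlt, hT⟩ hs.2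
  refine (key n le_rfl).trans ?_
  refine setIntegral_mono_set hGi ?_ (Ioc_subset_Ioc_right hn).eventuallyLE
  exact (ae_restrict_iff' measurableSet_Ioc).2 (Filter.Eventually.of_forall hG0)

/-! ### Convolution and Gronwall on a nonuniform mesh -/

variable {T : ℝ} {t : ℕ → ℝ}

theorem mesh_lt (ht : ∀ i < M, t i < t (i + 1)) {l m : ℕ} (hlm : l < m) (hm : m ≤ M) :
    t l < t m := by
  induction m with
  | zero => omega
  | succ m ih =>
    rcases Nat.lt_or_eq_of_le (Nat.le_of_lt_succ hlm) with h | h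
    · exact (ih h (by omega)).trans (ht m hm)
    · rw [h]; exact ht m hm

/-- Discrete convolution with a nonincreasing kernel on a nonuniform mesh is bounded on weighted
`ℓ^p` by the integral of the kernel. -/
theorem seqNorm_conv_le (hp : 1 ≤ p) (h0 : t 0 = 0) (hM : t M = T)
    (ht : ∀ i < M, t i < t (i + 1)) {G : ℝ → ℝ} (hG : AntitoneOn G (Ioc 0 T))
    (hG0 : ∀ s ∈ Ioc 0 T, 0 ≤ G s) (hGi : IntegrableOn G (Ioc 0 T))
    {x : ℕ → ℝ} (hx : ∀ i < M, 0 ≤ x i) :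
    seqNorm p (fun i => t (i + 1) - t i) M
      (fun m => ∑ l ∈ Finset.range (m + 1), (t (l + 1) - t l) * (G (t (m + 1) - t l) * x l))
      ≤ (∫ s in Ioc 0 T, G s) * seqNorm p (fun i => t (i + 1) - t i) M x := by
  have hk : ∀ i < M, 0 ≤ t (i + 1) - t i := fun i hi => sub_nonneg.2 (ht i hi).le
  have hle : ∀ l m, l ≤ m → m ≤ M → t l ≤ t m := fun l m hl hm => by
    rcases hl.eq_or_lt with h | h
    · rw [h]
    · exact (mesh_lt ht h hm).le
  have hmem : ∀ l m, l ≤ m → m < M → t (m + 1) - t l ∈ Ioc 0 T := fun l m hlm hm => by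
    refine ⟨sub_pos.2 (mesh_lt ht (by omega) hm), ?_⟩
    have h1 := hle (m + 1) M hm le_rfl
    have h2 := hle 0 l (by omega) (by omega)
    linarith
  have hI : 0 ≤ ∫ s in Ioc 0 T, G s := setIntegral_nonneg measurableSet_Ioc hG0
  have hcut : ∀ m < M, ∀ y : ℕ → ℝ, ∑ l ∈ Finset.range M, (t (l + 1) - t l) *
      ((if l ≤ m then G (t (m + 1) - t l) else 0) * y l)
      = ∑ l ∈ Finset.range (m + 1), (t (l + 1) - t l) * (G (t (m + 1) - t l) * y l) := by
    intro m hm y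
    symm
    rw [← Finset.sum_subset (Finset.range_subset_range.2 hm)]
    · refine Finset.sum_congr rfl fun l hl => ?_
      rw [if_pos (Nat.lt_succ_iff.1 (Finset.mem_range.1 hl))]
    · intro l _ hl
      rw [if_neg (by simpa [Nat.lt_succ_iff] using hl)]
      simp
  refine le_trans (seqNorm_mono hp hk (fun m hm => ?_) (fun m hm => (hcut m hm x).ge))
    (seqNorm_kernel_le (K := fun m l => if l ≤ m then G (t (m + 1) - t l) else 0) hp hk ?_ hI
      ?_ ?_ hx)
  · refine Finset.sum_nonneg fun l hl => ?_
    have hl := Nat.lt_succ_iff.1 (Finset.mem_range.1 hl)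
    exact mul_nonneg (hk l (by omega)) (mul_nonneg (hG0 _ (hmem l m hl hm)) (hx l (by omega)))
  · intro m hm l hl
    split_ifs with h
    · exact hG0 _ (hmem l m h hm)
    · exact le_rfl
  · intro m hm
    have h1 := hcut m hm (fun _ => 1)
    simp only [mul_one] at h1
    rw [h1]
    -- Row sums are right-endpoint Riemann sums for the mesh reflected about `t (m+1)`; the column
    -- sums below are such sums for the mesh translated by `t l`.
    have h2 := sum_antitone_le_integral hG hG0 hGi (fun i => t (m + 1) - t (m + 1 - i)) (m + 1)
      (by simp) (fun i hi => sub_lt_sub_left (mesh_lt ht (by omega) (by omega)) _) (by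
        have := hle (m + 1) M hm le_rfl
        simp only [Nat.sub_self, h0]
        linarith)
    refine le_trans (le_of_eq ?_) h2
    rw [← Finset.sum_range_reflect]
    refine Finset.sum_congr rfl fun i hi => ?_
    have hi := Finset.mem_range.1 hi
    rw [show m + 1 - 1 - i + 1 = m + 1 - i by omega, show m + 1 - 1 - i = m + 1 - (i + 1) by omega]
    ring
  · intro l hl
    have h2 := sum_antitone_le_integral hG hG0 hGi (fun i => t (l + i) - t l) (M - l)
      (by simp) (fun i hi => sub_lt_sub_right (mesh_lt ht (by omega) (by omega)) _) (by
        have := hle 0 l (by omega) hl.le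
        rw [show l + (M - l) = M by omega]
        linarith)
    refine le_trans (le_of_eq ?_) h2
    rw [Finset.range_eq_Ico, ← Finset.sum_Ico_consecutive _ (Nat.zero_le l) hl.le,
      Finset.sum_eq_zero, zero_add, Finset.sum_Ico_eq_sum_range]
    · refine Finset.sum_congr rfl fun i hi => ?_
      rw [if_pos (by omega)]
      simp only [← add_assoc]
      ring
    · intro i hi
      rw [if_neg (by simpa using hi)]
      simp

/-- The mass of the kernel `1/s` cut off at scale `ε`; with `ε` the minimal step it yields the
logarithm in the estimate. -/
theorem integral_inv_max {T ε : ℝ} (hε : 0 < ε) (hT : ε ≤ T) :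
    ∫ s in Ioc 0 T, (max s ε)⁻¹ = 1 + Real.log (T / ε) := by
  have hcont : Continuous fun s : ℝ => (max s ε)⁻¹ :=
    (continuous_id.max continuous_const).inv₀ fun s => (hε.trans_le (le_max_right _ _)).ne'
  rw [← intervalIntegral.integral_of_le (hε.le.trans hT),
    ← intervalIntegral.integral_add_adjacent_intervals (b := ε)
      (hcont.intervalIntegrable _ _) (hcont.intervalIntegrable _ _),
    ← integral_inv_of_pos hε (hε.trans_le hT)]
  congr 1
  · rw [intervalIntegral.integral_congr (g := fun _ => ε⁻¹)]
    · simp [hε.ne']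
    · intro s hs
      rw [uIcc_of_le hε.le] at hs
      simp only [max_eq_right hs.2]
  · refine intervalIntegral.integral_congr fun s hs => ?_
    rw [uIcc_of_le hT] at hs
    simp only [max_eq_left hs.1]

/-- A discrete Gronwall inequality in weighted `ℓ^p` with an integrable singular kernel `g`. -/
theorem seqNorm_gronwall (hp : 1 ≤ p) (h0 : t 0 = 0) (hM : t M = T)
    (ht : ∀ i < M, t i < t (i + 1)) {g : ℝ → ℝ} (hg : AntitoneOn g (Ioc 0 T))
    (hg0 : ∀ s ∈ Ioc 0 T, 0 ≤ g s) (hgi : IntegrableOn g (Ioc 0 T))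
    {κ ν C ε : ℝ} (hκ : 0 ≤ κ) (hν : 0 ≤ ν) (hC : 0 ≤ C)
    (hsmall : C * ∫ s in Ioc 0 T, g s * Real.exp (-(ν * s)) ≤ 1 / 2)
    (hε : 0 < ε) (hεT : ε ≤ T) (hεk : ∀ i < M, ε ≤ t (i + 1) - t i)
    (hr : ∀ i, i + 1 < M → t (i + 1) - t i ≤ κ * (t (i + 2) - t (i + 1)))
    {x F W : ℕ → ℝ} (hx : ∀ i < M, 0 ≤ x i) (hF : ∀ i < M, 0 ≤ F i) (hW : ∀ i < M, 0 ≤ W i)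
    (hxle : ∀ m < M, x m ≤
      ∑ l ∈ Finset.range (m + 1), (t (l + 1) - t l) * ((t (m + 1) - t l)⁻¹ * F l)
      + C * ∑ l ∈ Finset.range m, (t (l + 1) - t l) * (g (t (m + 1) - t l) * (x l + W l)))
    (hWle : ∀ m < M, W m ≤ ∑ l ∈ Finset.range (m + 1), (t (l + 1) - t l) * F l) :
    seqNorm p (fun i => t (i + 1) - t i) M x
      ≤ Real.exp (ν * (1 + κ) * T) * (2 * (1 + Real.log (T / ε)) + T)
        * seqNorm p (fun i => t (i + 1) - t i) M F := by
  have hT : 0 < T := hε.trans_le hεT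
  have hk : ∀ i < M, 0 ≤ t (i + 1) - t i := fun i hi => sub_nonneg.2 (ht i hi).le
  have hle : ∀ l m, l ≤ m → m ≤ M → t l ≤ t m := fun l m hl hm => by
    rcases hl.eq_or_lt with h | h
    · rw [h]
    · exact (mesh_lt ht h hm).le
  have hmem : ∀ l m, l ≤ m → m < M → t (m + 1) - t l ∈ Ioc 0 T := fun l m hlm hm => by
    refine ⟨sub_pos.2 (mesh_lt ht (by omega) hm), ?_⟩
    have h1 := hle (m + 1) M hm le_rfl
    have h2 := hle 0 l (by omega) (by omega)
    linarith
  set k : ℕ → ℝ := fun i => t (i + 1) - t i with hkdef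
  -- The weight sits at right endpoints while the kernel sees `t (m+1) - t l`, longer by one step.
  -- As `l < m`, that step is at most `κ (t (m+1) - t (l+1))`, so the rate `ν (1 + κ)` still pays
  -- for damping at rate `ν`.
  set N := ν * (1 + κ) with hN
  have hN0 : 0 ≤ N := by positivity
  set y : ℕ → ℝ := fun m => Real.exp (-(N * t (m + 1))) * x m with hy
  have hy0 : ∀ i < M, 0 ≤ y i := fun i hi => mul_nonneg (Real.exp_pos _).le (hx i hi)
  have ht0 : ∀ i ≤ M, 0 ≤ t i := fun i hi => h0 ▸ hle 0 i (by omega) hi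
  have hexp1 : ∀ i ≤ M, Real.exp (-(N * t i)) ≤ 1 := fun i hi =>
    Real.exp_le_one_iff.2 (by have := mul_nonneg hN0 (ht0 i hi); linarith)
  set G : ℝ → ℝ := fun s => g s * Real.exp (-(ν * s)) with hGdef
  have hG : AntitoneOn G (Ioc 0 T) := fun a ha b hb hab => by
    refine mul_le_mul (hg ha hb hab) (Real.exp_le_exp.2 ?_) (Real.exp_pos _).le (hg0 a ha)
    have := mul_le_mul_of_nonneg_left hab hν
    linarith
  have hG0 : ∀ s ∈ Ioc 0 T, 0 ≤ G s := fun s hs => mul_nonneg (hg0 s hs) (Real.exp_pos _).le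
  have hGi : IntegrableOn G (Ioc 0 T) := by
    refine Integrable.mono hgi (hgi.aestronglyMeasurable.mul
      (by fun_prop : Continuous fun s : ℝ => Real.exp (-(ν * s))).aestronglyMeasurable) ?_
    refine (ae_restrict_iff' measurableSet_Ioc).2 (Filter.Eventually.of_forall fun s hs => ?_)
    rw [norm_mul, Real.norm_of_nonneg (Real.exp_pos _).le]
    refine mul_le_of_le_one_right (norm_nonneg _) (Real.exp_le_one_iff.2 ?_)
    have := mul_nonneg hν hs.1.le
    linarith
  have hshift : ∀ m < M, ∀ l < m, Real.exp (-(N * t (m + 1))) ≤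
      Real.exp (-(ν * (t (m + 1) - t l))) * Real.exp (-(N * t (l + 1))) := by
    intro m hm l hl
    rw [← Real.exp_add]
    refine Real.exp_le_exp.2 ?_
    have h1 := hr l (by omega)
    have h2 := hle (l + 2) (m + 1) (by omega) hm
    have h3 : κ * (t (l + 2) - t (l + 1)) ≤ κ * (t (m + 1) - t (l + 1)) := by gcongr
    have h4 := mul_le_mul_of_nonneg_left (h1.trans h3) hν
    rw [hN]
    linarith
  have hyle : ∀ m < M, y m ≤
      (∑ l ∈ Finset.range (m + 1), k l * ((max (t (m + 1) - t l) ε)⁻¹ * F l))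
      + C * ((∑ l ∈ Finset.range (m + 1), k l * (G (t (m + 1) - t l) * y l))
        + ∑ l ∈ Finset.range (m + 1), k l * (G (t (m + 1) - t l) * W l)) := by
    intro m hm
    have hE := (Real.exp_pos (-(N * t (m + 1)))).le
    -- The cutoff changes nothing: every distance `t (m+1) - t l` contains a full step, hence is at
    -- least `ε`.
    have h1 : ∑ l ∈ Finset.range (m + 1), k l * ((t (m + 1) - t l)⁻¹ * F l)
        = ∑ l ∈ Finset.range (m + 1), k l * ((max (t (m + 1) - t l) ε)⁻¹ * F l) := by
      refine Finset.sum_congr rfl fun l hl => ?_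
      have hl := Nat.lt_succ_iff.1 (Finset.mem_range.1 hl)
      rw [max_eq_left]
      have := hle (l + 1) (m + 1) (by omega) hm
      have := hεk l (by omega)
      linarith
    have h1' : 0 ≤ ∑ l ∈ Finset.range (m + 1), k l * ((max (t (m + 1) - t l) ε)⁻¹ * F l) := by
      refine Finset.sum_nonneg fun l hl => ?_
      have hl := Nat.lt_succ_iff.1 (Finset.mem_range.1 hl)
      have := hk l (by omega)
      have := hF l (by omega)
      have := hε.trans_le (le_max_right (t (m + 1) - t l) ε)
      positivity
    have h2 : Real.exp (-(N * t (m + 1))) *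
        ∑ l ∈ Finset.range m, k l * (g (t (m + 1) - t l) * (x l + W l))
        ≤ ∑ l ∈ Finset.range (m + 1), k l * (G (t (m + 1) - t l) * (y l + W l)) := by
      rw [Finset.mul_sum]
      refine le_trans (Finset.sum_le_sum (g := fun l => k l * (G (t (m + 1) - t l) * (y l + W l)))
        fun l hl => ?_) (Finset.sum_le_sum_of_subset_of_nonneg
          (Finset.range_subset_range.2 (Nat.le_succ m)) fun l hl _ => ?_)
      · have hl := Finset.mem_range.1 hl
        have hkl := hk l (by omega)
        have hgl := hg0 _ (hmem l m hl.le hm)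
        have hxl := hx l (by omega)
        have hWl := hW l (by omega)
        calc Real.exp (-(N * t (m + 1))) * (k l * (g (t (m + 1) - t l) * (x l + W l)))
            ≤ (Real.exp (-(ν * (t (m + 1) - t l))) * Real.exp (-(N * t (l + 1)))) *
                (k l * (g (t (m + 1) - t l) * (x l + W l))) := by
              have : 0 ≤ k l := hkl
              gcongr
              exact hshift m hm l hl
          _ = k l * (G (t (m + 1) - t l) * (y l + Real.exp (-(N * t (l + 1))) * W l)) := by
              simp only [hGdef, hy]
              ring
          _ ≤ k l * (G (t (m + 1) - t l) * (y l + 1 * W l)) := by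
              have : 0 ≤ k l := hkl
              have := hG0 _ (hmem l m hl.le hm)
              gcongr
              exact hexp1 (l + 1) (by omega)
          _ = _ := by rw [one_mul]
      · have hl := Nat.lt_succ_iff.1 (Finset.mem_range.1 hl)
        exact mul_nonneg (hk l (by omega)) (mul_nonneg (hG0 _ (hmem l m hl hm))
          (add_nonneg (hy0 l (by omega)) (hW l (by omega))))
    have h3 := mul_le_mul_of_nonneg_left (hxle m hm) hE
    rw [mul_add, h1] at h3
    have h4 := mul_le_mul_of_nonneg_right (hexp1 (m + 1) hm) h1'
    have h5 := mul_le_mul_of_nonneg_left h2 hC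
    rw [← Finset.sum_add_distrib]
    simp only [← mul_add]
    simp only [hy] at h5 ⊢
    linarith
  have hconv : ∀ G' : ℝ → ℝ, (∀ s ∈ Ioc 0 T, 0 ≤ G' s) → ∀ x' : ℕ → ℝ, (∀ i < M, 0 ≤ x' i) →
      ∀ m < M, 0 ≤ ∑ l ∈ Finset.range (m + 1), k l * (G' (t (m + 1) - t l) * x' l) := by
    intro G' hG' x' hx' m hm
    refine Finset.sum_nonneg fun l hl => ?_
    have hl := Nat.lt_succ_iff.1 (Finset.mem_range.1 hl)
    exact mul_nonneg (hk l (by omega)) (mul_nonneg (hG' _ (hmem l m hl hm)) (hx' l (by omega)))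
  have hI0 : ∀ s ∈ Ioc 0 T, 0 ≤ (max s ε)⁻¹ := fun s _ =>
    inv_nonneg.2 (hε.le.trans (le_max_right _ _))
  have hcont : Continuous fun s : ℝ => (max s ε)⁻¹ :=
    (continuous_id.max continuous_const).inv₀ fun s => (hε.trans_le (le_max_right _ _)).ne'
  have n1 := seqNorm_conv_le hp h0 hM ht (G := fun s => (max s ε)⁻¹)
    (fun a _ b _ hab => inv_anti₀ (hε.trans_le (le_max_right _ _)) (max_le_max_right _ hab))
    hI0 (hcont.integrableOn_Ioc) hF
  rw [integral_inv_max hε hεT] at n1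
  have n2 := seqNorm_conv_le hp h0 hM ht hG hG0 hGi hy0
  have n3 := seqNorm_conv_le hp h0 hM ht hG hG0 hGi hW
  have n4 := seqNorm_conv_le hp h0 hM ht (G := fun _ => 1) (fun a _ b _ _ => le_rfl)
    (fun _ _ => zero_le_one) (by simp) hF
  simp only [one_mul] at n4
  have n4' : seqNorm p k M W ≤ T * seqNorm p k M F := by
    refine (seqNorm_mono hp hk hW hWle).trans (n4.trans (le_of_eq ?_))
    simp [hT.le, hkdef]
  have ny : seqNorm p k M y ≤ (1 + Real.log (T / ε)) * seqNorm p k M F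
      + C * ((∫ s in Ioc 0 T, G s) * seqNorm p k M y + (∫ s in Ioc 0 T, G s) * seqNorm p k M W) := by
    have c1 := hconv _ hI0 F hF
    have c2 := hconv _ hG0 y hy0
    have c3 := hconv _ hG0 W hW
    refine (seqNorm_mono hp hk hy0 hyle).trans ?_
    refine (seqNorm_add_le hp hk c1
      (fun m hm => mul_nonneg hC (add_nonneg (c2 m hm) (c3 m hm)))).trans ?_
    refine add_le_add n1 ?_
    rw [seqNorm_const_mul hp hk (fun m hm => add_nonneg (c2 m hm) (c3 m hm)) hC]
    refine mul_le_mul_of_nonneg_left ?_ hC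
    exact (seqNorm_add_le hp hk c2 c3).trans (add_le_add n2 n3)
  have sy := seqNorm_nonneg (p := p) hk hy0
  have sW := seqNorm_nonneg (p := p) hk hW
  have m1 := mul_le_mul_of_nonneg_right hsmall sy
  have m2 := mul_le_mul_of_nonneg_right hsmall sW
  -- With `L = 1 + log (T / ε)`: `‖y‖ ≤ L ‖F‖ + (‖y‖ + ‖W‖) / 2` and `‖W‖ ≤ T ‖F‖`, so half of `‖y‖`
  -- is absorbed.
  have ny' : seqNorm p k M y ≤ (2 * (1 + Real.log (T / ε)) + T) * seqNorm p k M F := by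
    nlinarith
  have hxy : seqNorm p k M x ≤ Real.exp (N * T) * seqNorm p k M y := by
    rw [← seqNorm_const_mul hp hk hy0 (Real.exp_pos _).le]
    refine seqNorm_mono hp hk hx fun m hm => ?_
    simp only [hy]
    rw [← mul_assoc, ← Real.exp_add]
    refine le_mul_of_one_le_left (hx m hm) (Real.one_le_exp ?_)
    have := mul_le_mul_of_nonneg_left (hle (m + 1) M hm le_rfl) hN0
    rw [hM] at this
    linarith
  calc _ ≤ Real.exp (N * T) * seqNorm p k M y := hxy
    _ ≤ Real.exp (N * T) * ((2 * (1 + Real.log (T / ε)) + T) * seqNorm p k M F) := by gcongr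
    _ = _ := by ring

/-- Exponential damping makes the integral of an integrable function small. -/
theorem exists_damping {T : ℝ} {g : ℝ → ℝ} (hgi : IntegrableOn g (Ioc 0 T)) {δ : ℝ} (hδ : 0 < δ) :
    ∃ ν : ℝ, 0 ≤ ν ∧ ∫ s in Ioc 0 T, g s * Real.exp (-(ν * s)) ≤ δ := by
  have hlim : Filter.Tendsto (fun ν : ℝ => ∫ s in Ioc 0 T, g s * Real.exp (-(ν * s)))
      Filter.atTop (nhds (∫ _ in Ioc 0 T, (0 : ℝ))) := by
    refine tendsto_integral_filter_of_dominated_convergence (fun s => ‖g s‖) ?_ ?_ hgi.norm ?_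
    · exact Filter.Eventually.of_forall fun ν => hgi.aestronglyMeasurable.mul
        (by fun_prop : Continuous fun s : ℝ => Real.exp (-(ν * s))).aestronglyMeasurable
    · filter_upwards [Filter.eventually_ge_atTop 0] with ν hν
      refine (ae_restrict_iff' measurableSet_Ioc).2 (Filter.Eventually.of_forall fun s hs => ?_)
      rw [norm_mul, Real.norm_of_nonneg (Real.exp_pos _).le]
      refine mul_le_of_le_one_right (norm_nonneg _) (Real.exp_le_one_iff.2 ?_)
      have := mul_nonneg hν hs.1.le
      linarith
    · refine (ae_restrict_iff' measurableSet_Ioc).2 (Filter.Eventually.of_forall fun s hs => ?_)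
      rw [show (0 : ℝ) = g s * 0 by ring]
      refine Filter.Tendsto.const_mul _ (Real.tendsto_exp_neg_atTop_nhds_zero.comp ?_)
      exact Filter.tendsto_id.atTop_mul_const hs.1
  rw [integral_zero] at hlim
  obtain ⟨ν, h1, h2⟩ := ((hlim.eventually (ge_mem_nhds hδ)).and
    (Filter.eventually_ge_atTop 0)).exists
  exact ⟨ν, h2, h1⟩

end Sequences

/-! ### The space `H¹₀(Ω)` and the form at a fixed time -/

section Forms

variable {d : ℕ} {Ω : Set (Space d)}

instance completeSpace_H10 (Ω : Set (Space d)) : CompleteSpace (H10 Ω) :=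
  (testPairs Ω).isClosed_topologicalClosure.completeSpace_coe

/-- The embedding `H¹₀(Ω) → L²(Ω)`. -/
noncomputable def embL2 (Ω : Set (Space d)) : H10 Ω →L[ℝ] L2 Ω :=
  (WithLp.fstL 2 ℝ (L2 Ω) (PiLp 2 (fun _ : Fin d => L2 Ω))).comp (H10 Ω).subtypeL

/-- The squared norm of the gradient. -/
noncomputable def gradSq (u : H10 Ω) : ℝ := ∑ i, ‖partialD i u‖ ^ 2

theorem gradSq_nonneg (u : H10 Ω) : 0 ≤ gradSq u := Finset.sum_nonneg fun _ _ => sq_nonneg _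

theorem norm_sq_eq_add_gradSq (u : H10 Ω) : ‖u‖ ^ 2 = ‖embL2 Ω u‖ ^ 2 + gradSq u := by
  rw [← Submodule.norm_coe, WithLp.prod_norm_sq_eq_of_L2, PiLp.norm_sq_eq_of_L2]
  rfl

theorem norm_partialD_le (i : Fin d) (u : H10 Ω) : ‖partialD i u‖ ≤ √(gradSq u) :=
  Real.le_sqrt_of_sq_le (Finset.single_le_sum (f := fun i => ‖partialD i u‖ ^ 2)
    (fun _ _ => sq_nonneg _) (Finset.mem_univ i))

theorem sqrt_gradSq_le_norm (u : H10 Ω) : √(gradSq u) ≤ ‖u‖ := by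
  refine Real.sqrt_le_iff.2 ⟨norm_nonneg _, ?_⟩
  rw [norm_sq_eq_add_gradSq]
  exact le_add_of_nonneg_left (sq_nonneg _)

theorem sum_norm_partialD_le (u v : H10 Ω) :
    ∑ i, ∑ j, ‖partialD i u‖ * ‖partialD j v‖ ≤ (d : ℝ) ^ 2 * (√(gradSq u) * √(gradSq v)) := by
  calc ∑ i, ∑ j, ‖partialD i u‖ * ‖partialD j v‖
      ≤ ∑ _i : Fin d, ∑ _j : Fin d, √(gradSq u) * √(gradSq v) := by
        gcongr <;> apply norm_partialD_le
    _ = _ := by simp; ring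

theorem partialD_add (i : Fin d) (u v : H10 Ω) :
    partialD i (u + v) = partialD i u + partialD i v := rfl

theorem partialD_smul (i : Fin d) (r : ℝ) (u : H10 Ω) :
    partialD i (r • u) = r • partialD i u := rfl

theorem integrable_mul_L2 (f g : L2 Ω) :
    Integrable (fun x => f x * g x) (volume.restrict Ω) :=
  (Lp.memLp f).integrable_mul (Lp.memLp g)

theorem integral_abs_mul_le (f g : L2 Ω) : ∫ x in Ω, |f x| * |g x| ≤ ‖f‖ * ‖g‖ := by
  have h1 := real_inner_le_norm |f| |g|
  rw [norm_abs_eq_norm, norm_abs_eq_norm, L2.inner_def] at h1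
  refine le_trans (le_of_eq (integral_congr_ae ?_)) h1
  filter_upwards [Lp.coeFn_abs f, Lp.coeFn_abs g] with x h2 h3
  rw [h2, h3]
  simp [mul_comm]

theorem abs_integral_weight_le {b : Space d → ℝ} {C : ℝ}
    (hb : ∀ᵐ x ∂volume.restrict Ω, |b x| ≤ C) (f g : L2 Ω) :
    |∫ x in Ω, b x * f x * g x| ≤ C * (‖f‖ * ‖g‖) := by
  -- On a null measure the hypothesis does not force `0 ≤ C`, but then both sides vanish.
  by_cases hΩ : (volume.restrict Ω : Measure (Space d)) = 0
  · have hf : ‖f‖ = 0 := by simp [Lp.norm_def, hΩ]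
    simp [hΩ, hf]
  have hC : 0 ≤ C := by
    have : (ae (volume.restrict Ω : Measure (Space d))).NeBot := ae_neBot.2 hΩ
    obtain ⟨x, hx⟩ := hb.exists
    exact (abs_nonneg _).trans hx
  have hi : Integrable (fun x => C * (|f x| * |g x|)) (volume.restrict Ω) := by
    have := ((integrable_mul_L2 f g).abs).const_mul C
    simpa only [abs_mul] using this
  refine (norm_integral_le_of_norm_le hi (f := fun x => b x * f x * g x) ?_).trans ?_
  · filter_upwards [hb] with x hx
    rw [mul_assoc, norm_mul, Real.norm_eq_abs, Real.norm_eq_abs, abs_mul]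
    gcongr
  · rw [integral_const_mul]
    gcongr
    exact integral_abs_mul_le f g

/-- At time `t` the coefficients are measurable, bounded by `K`, symmetric and elliptic. -/
structure IsGoodTime (Ω : Set (Space d)) (a : Coeff d) (α K : ℝ) (t : ℝ) : Prop where
  aesm : ∀ i j, AEStronglyMeasurable (a i j t) (volume.restrict Ω)
  bdd : ∀ i j, ∀ᵐ x ∂volume.restrict Ω, |a i j t x| ≤ K
  symm : ∀ i j, ∀ᵐ x ∂volume.restrict Ω, a i j t x = a j i t x
  elliptic : ∀ᵐ x ∂volume.restrict Ω, ∀ ξ : Space d,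
    α * ‖ξ‖ ^ 2 ≤ ∑ i, ∑ j, a i j t x * ξ i * ξ j

/-- Fubini passes from almost every `(t, x)` to almost every time slice. Summing the essential
bounds over `i, j` gives a single `K`. -/
theorem IsAdmissibleCoeff.exists_good {T : ℝ} {a : Coeff d} {α : ℝ} {ω : ℝ → ℝ}
    (ha : IsAdmissibleCoeff Ω T a α ω) :
    ∃ K, 0 ≤ K ∧ ∀ᵐ t ∂volume.restrict (Ioc 0 T), IsGoodTime Ω a α K t := by
  let K : ℝ := ∑ i, ∑ j, (eLpNorm (fun z : ℝ × Space d => a i j z.1 z.2) ⊤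
    ((volume.restrict (Ioo 0 T)).prod (volume.restrict Ω))).toReal
  refine ⟨K, Finset.sum_nonneg fun i _ => Finset.sum_nonneg fun j _ => ENNReal.toReal_nonneg, ?_⟩
  rw [← restrict_Ioo_eq_restrict_Ioc]
  have h1 : ∀ᵐ t ∂volume.restrict (Ioo 0 T), ∀ i j,
      AEStronglyMeasurable (a i j t) (volume.restrict Ω) :=
    ae_all_iff.2 fun i => ae_all_iff.2 fun j => (ha.memLp_top i j).1.prodMk_left
  have h2 : ∀ᵐ t ∂volume.restrict (Ioo 0 T), ∀ i j, ∀ᵐ x ∂volume.restrict Ω, |a i j t x| ≤ K := by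
    refine ae_all_iff.2 fun i => ae_all_iff.2 fun j => ?_
    refine Measure.ae_ae_of_ae_prod (p := fun z => |a i j z.1 z.2| ≤ K) ?_
    filter_upwards [ae_le_eLpNormEssSup (f := fun z : ℝ × Space d => a i j z.1 z.2)
      (μ := (volume.restrict (Ioo 0 T)).prod (volume.restrict Ω))] with z hz
    have hfin := (ha.memLp_top i j).2
    rw [← eLpNorm_exponent_top] at hz
    have h3 := ENNReal.toReal_mono hfin.ne hz
    rw [toReal_enorm, Real.norm_eq_abs] at h3
    refine h3.trans ?_
    refine le_trans ?_ (Finset.single_le_sum (fun i _ => Finset.sum_nonneg fun j _ =>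
      ENNReal.toReal_nonneg) (Finset.mem_univ i))
    exact Finset.single_le_sum (f := fun j => (eLpNorm (fun z : ℝ × Space d => a i j z.1 z.2) ⊤
      ((volume.restrict (Ioo 0 T)).prod (volume.restrict Ω))).toReal)
      (fun j _ => ENNReal.toReal_nonneg) (Finset.mem_univ j)
  have h3 : ∀ᵐ t ∂volume.restrict (Ioo 0 T), ∀ i j, ∀ᵐ x ∂volume.restrict Ω,
      a i j t x = a j i t x :=
    ae_all_iff.2 fun i => ae_all_iff.2 fun j => Measure.ae_ae_of_ae_prod (ha.symm i j)
  filter_upwards [h1, h2, h3, Measure.ae_ae_of_ae_prod ha.elliptic] with t e1 e2 e3 e4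
  exact ⟨e1, e2, e3, e4⟩

namespace IsGoodTime

variable {a : Coeff d} {α K t : ℝ}

theorem integrable_term (h : IsGoodTime Ω a α K t) (i j : Fin d) (f g : L2 Ω) :
    Integrable (fun x => a i j t x * f x * g x) (volume.restrict Ω) := by
  have := (integrable_mul_L2 f g).bdd_mul (c := K) (h.aesm i j)
    (by simpa only [Real.norm_eq_abs] using h.bdd i j)
  simpa only [mul_assoc] using this

theorem form_eq (h : IsGoodTime Ω a α K t) (u v : H10 Ω) :
    form a t u v = ∑ i, ∑ j, ∫ x in Ω, a i j t x * partialD i u x * partialD j v x := by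
  unfold form
  rw [integral_finsetSum _ fun i _ => integrable_finsetSum _ fun j _ => h.integrable_term i j _ _]
  refine Finset.sum_congr rfl fun i _ => ?_
  rw [integral_finsetSum _ fun j _ => h.integrable_term i j _ _]

theorem form_add_left (h : IsGoodTime Ω a α K t) (u u' v : H10 Ω) :
    form a t (u + u') v = form a t u v + form a t u' v := by
  simp only [h.form_eq, ← Finset.sum_add_distrib]
  refine Finset.sum_congr rfl fun i _ => Finset.sum_congr rfl fun j _ => ?_
  rw [← integral_add (h.integrable_term i j _ _) (h.integrable_term i j _ _)]
  refine integral_congr_ae ?_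
  filter_upwards [Lp.coeFn_add (partialD i u) (partialD i u')] with x hx
  rw [partialD_add, hx, Pi.add_apply]
  ring

theorem form_smul_left (h : IsGoodTime Ω a α K t) (r : ℝ) (u v : H10 Ω) :
    form a t (r • u) v = r * form a t u v := by
  simp only [h.form_eq, Finset.mul_sum]
  refine Finset.sum_congr rfl fun i _ => Finset.sum_congr rfl fun j _ => ?_
  rw [← integral_const_mul]
  refine integral_congr_ae ?_
  filter_upwards [Lp.coeFn_smul r (partialD i u)] with x hx
  rw [partialD_smul, hx, Pi.smul_apply, smul_eq_mul]
  ring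

theorem form_symm (h : IsGoodTime Ω a α K t) (u v : H10 Ω) : form a t u v = form a t v u := by
  simp only [h.form_eq]
  rw [Finset.sum_comm]
  refine Finset.sum_congr rfl fun i _ => Finset.sum_congr rfl fun j _ => ?_
  refine integral_congr_ae ?_
  filter_upwards [h.symm i j] with x hx
  rw [hx]
  ring

theorem abs_form_le (h : IsGoodTime Ω a α K t) (hK : 0 ≤ K) (u v : H10 Ω) :
    |form a t u v| ≤ K * (d : ℝ) ^ 2 * (√(gradSq u) * √(gradSq v)) := by
  rw [h.form_eq, mul_assoc]
  calc _ ≤ ∑ i, ∑ j, K * (‖partialD i u‖ * ‖partialD j v‖) := by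
        refine (Finset.abs_sum_le_sum_abs _ _).trans (Finset.sum_le_sum fun i _ => ?_)
        refine (Finset.abs_sum_le_sum_abs _ _).trans (Finset.sum_le_sum fun j _ => ?_)
        exact abs_integral_weight_le (h.bdd i j) _ _
    _ = K * ∑ i, ∑ j, ‖partialD i u‖ * ‖partialD j v‖ := by simp only [Finset.mul_sum]
    _ ≤ _ := by gcongr; exact sum_norm_partialD_le u v

theorem form_ge (h : IsGoodTime Ω a α K t) (u : H10 Ω) : α * gradSq u ≤ form a t u u := by
  have e1 : gradSq u = ∫ x in Ω, ∑ i, partialD i u x * partialD i u x := by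
    rw [integral_finsetSum _ fun i _ => integrable_mul_L2 _ _]
    refine Finset.sum_congr rfl fun i _ => ?_
    rw [← real_inner_self_eq_norm_sq, L2.inner_def]
    rfl
  rw [e1, ← integral_const_mul]
  refine integral_mono_ae ((integrable_finsetSum _ fun i _ => integrable_mul_L2 _ _).const_mul _)
    (integrable_finsetSum _ fun i _ => integrable_finsetSum _ fun j _ =>
      h.integrable_term i j _ _) ?_
  filter_upwards [h.elliptic] with x hx
  have h2 := hx (WithLp.toLp 2 fun i => partialD i u x)
  rw [EuclideanSpace.norm_sq_eq] at h2
  simpa [← sq] using h2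

theorem abs_form_sub_le (h : IsGoodTime Ω a α K t) {s w : ℝ} (h' : IsGoodTime Ω a α K s)
    (hw : 0 ≤ w) (hm : ∀ i j, ∀ᵐ x ∂volume.restrict Ω, |a i j t x - a i j s x| ≤ w)
    (u v : H10 Ω) :
    |form a t u v - form a s u v| ≤ w * (d : ℝ) ^ 2 * (√(gradSq u) * √(gradSq v)) := by
  rw [h.form_eq, h'.form_eq, mul_assoc]
  simp only [← Finset.sum_sub_distrib]
  calc _ ≤ ∑ i, ∑ j, w * (‖partialD i u‖ * ‖partialD j v‖) := by
        refine (Finset.abs_sum_le_sum_abs _ _).trans (Finset.sum_le_sum fun i _ => ?_)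
        refine (Finset.abs_sum_le_sum_abs _ _).trans (Finset.sum_le_sum fun j _ => ?_)
        rw [← integral_sub (h.integrable_term i j _ _) (h'.integrable_term i j _ _)]
        simp only [← sub_mul]
        exact abs_integral_weight_le (hm i j) _ _
    _ = w * ∑ i, ∑ j, ‖partialD i u‖ * ‖partialD j v‖ := by simp only [Finset.mul_sum]
    _ ≤ _ := by gcongr; exact sum_norm_partialD_le u v

end IsGoodTime

/-- Valid at every time, since the integrand vanishes almost everywhere whatever the coefficients
are. -/
theorem form_zero_right (a : Coeff d) (t : ℝ) (u : H10 Ω) : form a t u 0 = 0 := by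
  unfold form
  have hz : ∀ᵐ x ∂volume.restrict Ω, ((0 : L2 Ω) : Space d → ℝ) x = 0 := by
    filter_upwards [Lp.coeFn_zero ℝ 2 (volume.restrict Ω)] with x hx
    exact hx
  rw [integral_congr_ae (g := fun _ => 0), integral_zero]
  filter_upwards [hz] with x hx
  refine Finset.sum_eq_zero fun i _ => Finset.sum_eq_zero fun j _ => ?_
  have hj : (partialD j (0 : H10 Ω) : Space d → ℝ) x = 0 := hx
  rw [hj, mul_zero]

theorem IsAdmissibleCoeff.integrableOn_form {T : ℝ} {a : Coeff d} {α : ℝ} {ω : ℝ → ℝ}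
    (ha : IsAdmissibleCoeff Ω T a α ω) (u v : H10 Ω) :
    IntegrableOn (fun t => form a t u v) (Ioc 0 T) := by
  obtain ⟨K, hK, hgood⟩ := ha.exists_good
  have hmeas : AEStronglyMeasurable (fun t => form a t u v) (volume.restrict (Ioc 0 T)) := by
    rw [← restrict_Ioo_eq_restrict_Ioc]
    have : AEStronglyMeasurable (fun z : ℝ × Space d =>
        ∑ i, ∑ j, a i j z.1 z.2 * partialD i u z.2 * partialD j v z.2)
        ((volume.restrict (Ioo 0 T)).prod (volume.restrict Ω)) := by
      refine Finset.aestronglyMeasurable_fun_sum _ fun i _ =>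
        Finset.aestronglyMeasurable_fun_sum _ fun j _ => ?_
      exact ((ha.memLp_top i j).1.mul (Lp.aestronglyMeasurable (partialD i u)).comp_snd).mul
        (Lp.aestronglyMeasurable (partialD j v)).comp_snd
    exact this.integral_prod_right'
  refine Integrable.of_bound hmeas (K * (d : ℝ) ^ 2 * (√(gradSq u) * √(gradSq v))) ?_
  filter_upwards [hgood] with t ht
  exact ht.abs_form_le hK u v

end Forms

/-! ### Averaged operators -/

section Averages

variable {d : ℕ} {Ω : Set (Space d)} {T : ℝ}

theorem TimeMesh.t_mono (𝒯 : TimeMesh T) {l m : ℕ} (hlm : l ≤ m) (hm : m ≤ 𝒯.M) :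
    𝒯.t l ≤ 𝒯.t m := by
  rcases hlm.eq_or_lt with h | h
  · rw [h]
  · exact (mesh_lt 𝒯.t_lt h hm).le

theorem TimeMesh.interval_subset (𝒯 : TimeMesh T) {i : ℕ} (hi : i < 𝒯.M) :
    𝒯.interval (i + 1) ⊆ Ioc 0 T :=
  Ioc_subset_Ioc (𝒯.t_zero.symm.le.trans (𝒯.t_mono (Nat.zero_le _) (by simpa using hi.le)))
    ((𝒯.t_mono (Nat.succ_le_of_lt hi) le_rfl).trans 𝒯.t_last.le)

theorem TimeMesh.volume_real_interval (𝒯 : TimeMesh T) {i : ℕ} (hi : i < 𝒯.M) :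
    volume.real (𝒯.interval (i + 1)) = 𝒯.step (i + 1) := by
  simp only [interval, step, Nat.add_sub_cancel]
  exact Real.volume_real_Ioc_of_le (𝒯.t_lt i hi).le

theorem TimeMesh.volume_interval_ne_zero (𝒯 : TimeMesh T) {i : ℕ} (hi : i < 𝒯.M) :
    volume (𝒯.interval (i + 1)) ≠ 0 := by
  simp [interval, 𝒯.t_lt i hi]

theorem TimeMesh.volume_interval_ne_top (𝒯 : TimeMesh T) (i : ℕ) :
    volume (𝒯.interval i) ≠ ⊤ := by
  simp [interval]

theorem avgOp_eq_average (a : Coeff d) (𝒯 : TimeMesh T) {i : ℕ} (hi : i < 𝒯.M) (u v : H10 Ω) :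
    avgOp a 𝒯 (i + 1) u v = ⨍ s in 𝒯.interval (i + 1), form a s u v := by
  rw [setAverage_eq, 𝒯.volume_real_interval hi]
  rfl

variable {a : Coeff d} {α K : ℝ} {ω : ℝ → ℝ} {𝒯 : TimeMesh T} {i : ℕ}

/-- An average stays in any closed convex set containing almost all values. Boundedness, coercivity
and the modulus of continuity of the averaged forms all follow, with balls and half-lines as `S`. -/
theorem avgOp_mem (ha : IsAdmissibleCoeff Ω T a α ω) (hi : i < 𝒯.M) (u v : H10 Ω) {S : Set ℝ}
    (hS : Convex ℝ S) (hSc : IsClosed S)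
    (h : ∀ᵐ s ∂volume.restrict (𝒯.interval (i + 1)), form a s u v ∈ S) :
    avgOp a 𝒯 (i + 1) u v ∈ S := by
  rw [avgOp_eq_average a 𝒯 hi]
  exact hS.set_average_mem hSc (𝒯.volume_interval_ne_zero hi) (𝒯.volume_interval_ne_top _) h
    ((ha.integrableOn_form u v).mono_set (𝒯.interval_subset hi))

/-- The averaged form as a continuous bilinear form. -/
theorem exists_avgOp_bilinear (ha : IsAdmissibleCoeff Ω T a α ω) (hi : i < 𝒯.M) :
    ∃ B : H10 Ω →L[ℝ] H10 Ω →L[ℝ] ℝ, (∀ u v, B u v = avgOp a 𝒯 (i + 1) u v) ∧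
      (∀ u v, B u v = B v u) ∧ ∀ u, α * gradSq u ≤ B u u := by
  obtain ⟨K, hK, hgood⟩ := ha.exists_good
  have hgood' := ae_restrict_of_ae_restrict_of_subset (𝒯.interval_subset hi) hgood
  have hint : ∀ u v : H10 Ω, IntegrableOn (fun s => form a s u v) (𝒯.interval (i + 1)) :=
    fun u v => (ha.integrableOn_form u v).mono_set (𝒯.interval_subset hi)
  have hsymm : ∀ u v : H10 Ω, avgOp a 𝒯 (i + 1) u v = avgOp a 𝒯 (i + 1) v u := fun u v => by
    unfold avgOp
    congr 1
    refine integral_congr_ae ?_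
    filter_upwards [hgood'] with s hs using hs.form_symm u v
  have hadd : ∀ u u' v : H10 Ω, avgOp a 𝒯 (i + 1) (u + u') v
      = avgOp a 𝒯 (i + 1) u v + avgOp a 𝒯 (i + 1) u' v := fun u u' v => by
    unfold avgOp
    rw [← mul_add, ← integral_add (hint u v) (hint u' v)]
    congr 1
    refine integral_congr_ae ?_
    filter_upwards [hgood'] with s hs using hs.form_add_left u u' v
  have hsmul : ∀ (r : ℝ) (u v : H10 Ω), avgOp a 𝒯 (i + 1) (r • u) v
      = r * avgOp a 𝒯 (i + 1) u v := fun r u v => by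
    unfold avgOp
    rw [mul_left_comm, ← integral_const_mul r]
    congr 1
    refine integral_congr_ae ?_
    filter_upwards [hgood'] with s hs using hs.form_smul_left r u v
  let L : H10 Ω →ₗ[ℝ] H10 Ω →ₗ[ℝ] ℝ := LinearMap.mk₂ ℝ (avgOp a 𝒯 (i + 1)) hadd
    (fun r u v => hsmul r u v)
    (fun u v v' => by rw [hsymm, hadd, hsymm v, hsymm v'])
    (fun r u v => by rw [hsymm, hsmul, hsymm v]; rfl)
  refine ⟨L.mkContinuous₂ (K * (d : ℝ) ^ 2) fun u v => ?_, fun u v => rfl, hsymm, fun u => ?_⟩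
  · have h1 : avgOp a 𝒯 (i + 1) u v ∈ Metric.closedBall (0 : ℝ)
        (K * (d : ℝ) ^ 2 * (√(gradSq u) * √(gradSq v))) := by
      refine avgOp_mem ha hi u v (convex_closedBall _ _) Metric.isClosed_closedBall ?_
      filter_upwards [hgood'] with s hs
      rw [mem_closedBall_zero_iff, Real.norm_eq_abs]
      exact hs.abs_form_le hK u v
    rw [mem_closedBall_zero_iff] at h1
    refine h1.trans ?_
    rw [mul_assoc (K * (d : ℝ) ^ 2) ‖u‖]
    gcongr
    · exact sqrt_gradSq_le_norm u
    · exact sqrt_gradSq_le_norm v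
  · have h1 : avgOp a 𝒯 (i + 1) u u ∈ Ici (α * gradSq u) := by
      refine avgOp_mem ha hi u u (convex_Ici _) isClosed_Ici ?_
      filter_upwards [hgood'] with s hs using hs.form_ge u
    exact h1

/-- Times in the two intervals are at most `t (m+1) - t l` apart, so the pointwise bound passes to
the averages, one variable at a time. This distance is also the elapsed time in the smoothing
estimates. -/
theorem abs_avgOp_sub_le (ha : IsAdmissibleCoeff Ω T a α ω) (hω : IsModulus T ω) {l m : ℕ}
    (hlm : l ≤ m) (hm : m < 𝒯.M) (u v : H10 Ω) :
    |avgOp a 𝒯 (m + 1) u v - avgOp a 𝒯 (l + 1) u v|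
      ≤ ω (𝒯.t (m + 1) - 𝒯.t l) * (d : ℝ) ^ 2 * (√(gradSq u) * √(gradSq v)) := by
  obtain ⟨K, hK, hgood⟩ := ha.exists_good
  have hl : l < 𝒯.M := hlm.trans_lt hm
  have hgm := ae_restrict_of_ae_restrict_of_subset (𝒯.interval_subset hm) hgood
  have hgl := ae_restrict_of_ae_restrict_of_subset (𝒯.interval_subset hl) hgood
  have hmm : ∀ᵐ s ∂volume.restrict (𝒯.interval (m + 1)), s ∈ 𝒯.interval (m + 1) :=
    ae_restrict_mem measurableSet_Ioc
  have hml : ∀ᵐ s ∂volume.restrict (𝒯.interval (l + 1)), s ∈ 𝒯.interval (l + 1) :=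
    ae_restrict_mem measurableSet_Ioc
  set R := ω (𝒯.t (m + 1) - 𝒯.t l) * (d : ℝ) ^ 2 * (√(gradSq u) * √(gradSq v)) with hR
  have hτ : 𝒯.t (m + 1) - 𝒯.t l ∈ Icc 0 T := by
    have h1 := 𝒯.t_mono (show l ≤ m + 1 by omega) hm
    have h2 := 𝒯.t_mono (Nat.succ_le_of_lt hm) le_rfl
    have h3 := 𝒯.t_mono (Nat.zero_le l) hl.le
    rw [𝒯.t_last] at h2
    rw [𝒯.t_zero] at h3
    constructor
    · linarith
    · have : 𝒯.t (m + 1) ≤ T := h2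
      linarith
  have hpt : ∀ᵐ r ∂volume.restrict (𝒯.interval (l + 1)),
      form a r u v ∈ Metric.closedBall (avgOp a 𝒯 (m + 1) u v) R := by
    filter_upwards [hgl, hml] with r hr hrI
    rw [Metric.mem_closedBall_comm]
    refine avgOp_mem ha hm u v (convex_closedBall _ _) Metric.isClosed_closedBall ?_
    filter_upwards [hgm, hmm] with s hs hsI
    have hr0 := 𝒯.interval_subset hl hrI
    have hs0 := 𝒯.interval_subset hm hsI
    have h4 : |s - r| ≤ 𝒯.t (m + 1) - 𝒯.t l := by
      have h5 := 𝒯.t_mono hlm hm.le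
      have h6 := 𝒯.t_mono (show l + 1 ≤ m + 1 by omega) hm
      have h7 : 𝒯.t m < s := hsI.1
      have h8 : s ≤ 𝒯.t (m + 1) := hsI.2
      have h9 : 𝒯.t l < r := hrI.1
      have h10 : r ≤ 𝒯.t (l + 1) := hrI.2
      rw [abs_le]
      constructor <;> linarith
    rw [Metric.mem_closedBall, Real.dist_eq]
    refine hs.abs_form_sub_le hr (hω.nonneg _ hτ) (fun i j => ?_) u v
    filter_upwards [ha.modulus i j s ⟨hs0.1.le, hs0.2⟩ r ⟨hr0.1.le, hr0.2⟩] with x hx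
    exact hx.trans (hω.monotoneOn ⟨abs_nonneg _, h4.trans hτ.2⟩ hτ h4)
  have := avgOp_mem ha hl u v (convex_closedBall _ _) Metric.isClosed_closedBall hpt
  rw [Metric.mem_closedBall_comm, Metric.mem_closedBall, Real.dist_eq] at this
  exact this

end Averages

/-! ### The dG(0) method as an implicit Euler scheme -/

section Scheme

variable {d : ℕ} {Ω : Set (Space d)} {T : ℝ} {𝒯 : TimeMesh T}

theorem TimeMesh.step_succ (𝒯 : TimeMesh T) (i : ℕ) : 𝒯.step (i + 1) = 𝒯.t (i + 1) - 𝒯.t i := rfl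

theorem TimeMesh.step_pos (𝒯 : TimeMesh T) {i : ℕ} (hi : i < 𝒯.M) : 0 < 𝒯.step (i + 1) :=
  sub_pos.2 (𝒯.t_lt i hi)

theorem TimeMesh.kMin_le (𝒯 : TimeMesh T) {i : ℕ} (hi : i < 𝒯.M) :
    𝒯.kMin ≤ 𝒯.t (i + 1) - 𝒯.t i :=
  Finset.inf'_le 𝒯.step (Finset.mem_Icc.2 ⟨Nat.succ_pos i, hi⟩)

theorem TimeMesh.kMin_pos (𝒯 : TimeMesh T) : 0 < 𝒯.kMin := by
  refine (Finset.lt_inf'_iff _).2 fun m hm => ?_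
  obtain ⟨h1, h2⟩ := Finset.mem_Icc.1 hm
  obtain ⟨i, rfl⟩ : ∃ i, m = i + 1 := ⟨m - 1, by omega⟩
  exact 𝒯.step_pos h2

theorem TimeMesh.kMin_le_kMax (𝒯 : TimeMesh T) : 𝒯.kMin ≤ 𝒯.kMax :=
  (Finset.inf'_le 𝒯.step (Finset.mem_Icc.2 ⟨le_rfl, 𝒯.one_le⟩)).trans
    (Finset.le_sup' 𝒯.step (Finset.mem_Icc.2 ⟨le_rfl, 𝒯.one_le⟩))

theorem sum_Icc_one_eq (M : ℕ) (h : ℕ → ℝ) :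
    ∑ m ∈ Finset.Icc 1 M, h m = ∑ i ∈ Finset.range M, h (i + 1) := by
  rw [Finset.range_eq_Ico, Finset.sum_Ico_add' h 0 M 1]
  rfl

/-- The mean value of `f` on the time interval with (zero-based) index `i`. -/
noncomputable def meanValue (𝒯 : TimeMesh T) (f : ℝ → L2 Ω) (i : ℕ) : L2 Ω :=
  ⨍ s in 𝒯.interval (i + 1), f s

/-- The nodal values in `L²(Ω)` of a solution with zero initial value. -/
noncomputable def nodalValue (u : ℕ → H10 Ω) : ℕ → L2 Ω
  | 0 => 0
  | i + 1 => toL2 (u (i + 1))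

/-- The values of the averaged operators on a solution with zero initial value, as elements of
`L²(Ω)`, with zero-based index. -/
noncomputable def operatorValue (𝒯 : TimeMesh T) (f : ℝ → L2 Ω) (u : ℕ → H10 Ω) (i : ℕ) : L2 Ω :=
  meanValue 𝒯 f i - (𝒯.step (i + 1))⁻¹ • (nodalValue u (i + 1) - nodalValue u i)

theorem jump_succ (u : ℕ → H10 Ω) (i : ℕ) :
    jump 0 u (i + 1) = nodalValue u (i + 1) - nodalValue u i := by
  cases i with
  | zero => simp [jump, nodalValue]
  | succ i => simp [jump, nodalValue]

theorem integral_eq_step_smul_meanValue {f : ℝ → L2 Ω} {i : ℕ} (hi : i < 𝒯.M) :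
    ∫ s in 𝒯.interval (i + 1), f s = 𝒯.step (i + 1) • meanValue 𝒯 f i := by
  rw [meanValue, setAverage_eq, 𝒯.volume_real_interval hi, smul_inv_smul₀ (𝒯.step_pos hi).ne']

/-- The equation of the dG(0) method on a single time interval. -/
theorem IsDG0Solution.local_eq {a : Coeff d} {f : ℝ → L2 Ω} {u : ℕ → H10 Ω}
    (h : IsDG0Solution a 𝒯 0 f u) (hf : IntegrableOn f (Ioc 0 T)) {i : ℕ} (hi : i < 𝒯.M)
    (w : H10 Ω) :
    (∫ s in 𝒯.interval (i + 1), form a s (u (i + 1)) w)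
      + inner ℝ (nodalValue u (i + 1) - nodalValue u i) (toL2 w)
      = inner ℝ (∫ s in 𝒯.interval (i + 1), f s) (toL2 w) := by
  -- A test function supported on a single interval isolates one step.
  have h1 := h (Pi.single (i + 1) w)
  have hz : toL2 (0 : H10 Ω) = 0 := rfl
  have hne : ∀ m, m ≠ i + 1 → (Pi.single (i + 1) w : ℕ → H10 Ω) m = 0 := fun m hm => by
    simp [hm]
  have hmem : i + 1 ∈ Finset.Icc 1 𝒯.M := Finset.mem_Icc.2 ⟨Nat.succ_pos i, hi⟩
  unfold formB at h1
  rw [Finset.sum_eq_single_of_mem (i + 1) hmem, Finset.sum_eq_single_of_mem (i + 1) hmem,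
    inner_zero_left, add_zero, Pi.single_eq_same] at h1
  · have e2 : ∫ s in 𝒯.interval (i + 1), inner ℝ (f s) (toL2 w)
        = inner ℝ (∫ s in 𝒯.interval (i + 1), f s) (toL2 w) := by
      rw [real_inner_comm, ← integral_inner (hf.mono_set (𝒯.interval_subset hi))]
      simp only [real_inner_comm]
    rw [← e2, ← h1, add_assoc]
    congr 1
    -- On the first interval the jump comes from the separate `u 1` term; afterwards it comes from
    -- the sum starting at `m = 2`.
    cases i with
    | zero =>
      rw [Finset.sum_eq_zero]
      · simp [nodalValue]
      · intro m hm
        have := (Finset.mem_Icc.1 hm).1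
        rw [hne m (by omega), hz, inner_zero_right]
    | succ i =>
      rw [Finset.sum_eq_single_of_mem (i + 1 + 1) (Finset.mem_Icc.2 ⟨by omega, hi⟩),
        hne 1 (by omega), hz, inner_zero_right, add_zero, Pi.single_eq_same]
      · rfl
      · intro m _ hm
        rw [hne m hm, hz, inner_zero_right]
  · intro m _ hm
    simp [hne m hm, hz]
  · intro m _ hm
    simp [hne m hm, form_zero_right]

/-- The local equation says exactly this, so no elliptic regularity is needed for the values to lie
in `L²`. -/
theorem IsDG0Solution.isL2Rep {a : Coeff d} {f : ℝ → L2 Ω} {u : ℕ → H10 Ω}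
    (h : IsDG0Solution a 𝒯 0 f u) (hf : IntegrableOn f (Ioc 0 T)) {i : ℕ} (hi : i < 𝒯.M) :
    IsL2Rep (avgOp a 𝒯 (i + 1) (u (i + 1))) (operatorValue 𝒯 f u i) := by
  intro w
  have h1 := h.local_eq hf hi w
  rw [integral_eq_step_smul_meanValue hi, real_inner_smul_left] at h1
  have hs := 𝒯.step_pos hi
  rw [avgOp, operatorValue, inner_sub_left, real_inner_smul_left, eq_sub_of_add_eq h1]
  field_simp

theorem timeNorm_const_rpow {p : ℝ} (hp : 1 ≤ p) {i : ℕ} (hi : i < 𝒯.M) (g : L2 Ω) :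
    timeNorm p (𝒯.interval (i + 1)) (fun _ => g) ^ p = 𝒯.step (i + 1) * ‖g‖ ^ p := by
  have hp0 : 0 < p := by positivity
  rw [timeNorm, eLpNorm_const' _ (by simpa using hp0) ENNReal.ofReal_ne_top,
    Measure.restrict_apply_univ, ENNReal.toReal_mul, toReal_enorm, ← ENNReal.toReal_rpow,
    ENNReal.toReal_ofReal hp0.le, ← measureReal_def, 𝒯.volume_real_interval hi,
    Real.mul_rpow (norm_nonneg _) (Real.rpow_nonneg (𝒯.step_pos hi).le _),
    ← Real.rpow_mul (𝒯.step_pos hi).le, one_div_mul_cancel hp0.ne', Real.rpow_one, mul_comm]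

/-- Jensen's inequality for `x ↦ x ^ p`. -/
theorem step_mul_norm_meanValue_rpow_le {p : ℝ} (hp : 1 ≤ p) {f : ℝ → L2 Ω}
    (hf : IntegrableOn f (Ioc 0 T)) (hfp : IntegrableOn (fun s => ‖f s‖ ^ p) (Ioc 0 T)) {i : ℕ}
    (hi : i < 𝒯.M) :
    𝒯.step (i + 1) * ‖meanValue 𝒯 f i‖ ^ p ≤ ∫ s in 𝒯.interval (i + 1), ‖f s‖ ^ p := by
  have hp0 : 0 < p := by positivity
  have hi1 := hf.mono_set (𝒯.interval_subset hi)
  have hi2 := hfp.mono_set (𝒯.interval_subset hi)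
  have hs := 𝒯.step_pos hi
  have h1 : ‖meanValue 𝒯 f i‖ ≤ ⨍ s in 𝒯.interval (i + 1), ‖f s‖ := by
    rw [meanValue, setAverage_eq, setAverage_eq, norm_smul, norm_inv, smul_eq_mul,
      Real.norm_of_nonneg measureReal_nonneg]
    gcongr
    exact norm_integral_le_integral_norm _
  have h2 := (convexOn_rpow hp).map_set_average_le
    (Real.continuous_rpow_const hp0.le).continuousOn isClosed_Ici
    (𝒯.volume_interval_ne_zero hi) (𝒯.volume_interval_ne_top _)
    (f := fun s => ‖f s‖) (Filter.Eventually.of_forall fun s => norm_nonneg _) hi1.norm hi2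
  calc 𝒯.step (i + 1) * ‖meanValue 𝒯 f i‖ ^ p
      ≤ 𝒯.step (i + 1) * (⨍ s in 𝒯.interval (i + 1), ‖f s‖) ^ p := by gcongr
    _ ≤ 𝒯.step (i + 1) * ⨍ s in 𝒯.interval (i + 1), ‖f s‖ ^ p := by gcongr
    _ = _ := by
      rw [setAverage_eq, 𝒯.volume_real_interval hi, smul_eq_mul, mul_inv_cancel_left₀ hs.ne']

theorem sum_integral_interval {h : ℝ → ℝ} (hh : IntegrableOn h (Ioc 0 T)) :
    ∑ i ∈ Finset.range 𝒯.M, ∫ s in 𝒯.interval (i + 1), h s = ∫ s in Ioc 0 T, h s := by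
  have hint : ∀ i < 𝒯.M, IntervalIntegrable h volume (𝒯.t i) (𝒯.t (i + 1)) := fun i hi =>
    (intervalIntegrable_iff_integrableOn_Ioc_of_le (𝒯.t_lt i hi).le).2
      (hh.mono_set (𝒯.interval_subset hi))
  have h1 := intervalIntegral.sum_integral_adjacent_intervals hint
  rw [𝒯.t_zero, 𝒯.t_last, intervalIntegral.integral_of_le] at h1
  · rw [← h1]
    refine Finset.sum_congr rfl fun i hi => ?_
    rw [intervalIntegral.integral_of_le (𝒯.t_lt i (Finset.mem_range.1 hi)).le]
    rfl
  · rw [← 𝒯.t_last, ← 𝒯.t_zero]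
    exact 𝒯.t_mono (Nat.zero_le _) le_rfl

theorem seqNorm_meanValue_le {p : ℝ} (hp : 1 ≤ p) {f : ℝ → L2 Ω}
    (hf : MemLp f (ENNReal.ofReal p) (volume.restrict (Ioo 0 T))) :
    seqNorm p (fun i => 𝒯.t (i + 1) - 𝒯.t i) 𝒯.M (fun i => ‖meanValue 𝒯 f i‖)
      ≤ timeNorm p (Ioo 0 T) f := by
  have hp0 : 0 < p := by positivity
  have hne : ENNReal.ofReal p ≠ 0 := by simpa using hp0
  have hp1 : 1 ≤ ENNReal.ofReal p := by simpa using hp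
  have hfp := hf.integrable_norm_rpow hne ENNReal.ofReal_ne_top
  have hf1 := hf.integrable hp1
  have hnorm := hf.eLpNorm_eq_integral_rpow_norm hne ENNReal.ofReal_ne_top
  rw [ENNReal.toReal_ofReal hp0.le, restrict_Ioo_eq_restrict_Ioc] at hnorm hfp
  rw [restrict_Ioo_eq_restrict_Ioc] at hf1
  have hI : 0 ≤ ∫ s in Ioc 0 T, ‖f s‖ ^ p := integral_nonneg fun s => by positivity
  rw [timeNorm, restrict_Ioo_eq_restrict_Ioc, hnorm, ENNReal.toReal_ofReal (by positivity),
    ← sum_integral_interval (𝒯 := 𝒯) hfp, seqNorm, one_div]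
  refine Real.rpow_le_rpow (Finset.sum_nonneg fun i hi => ?_) (Finset.sum_le_sum fun i hi => ?_)
    (by positivity)
  · exact mul_nonneg (sub_nonneg.2 (𝒯.t_lt i (Finset.mem_range.1 hi)).le) (by positivity)
  · exact step_mul_norm_meanValue_rpow_le hp hf1 hfp (Finset.mem_range.1 hi)

/-- Mesh with minimal step at least a power of the maximal step: the two logarithms are
comparable. -/
theorem log_div_kMin_le {c β κ : ℝ} (hT : 0 < T) (hc : 0 < c) (h : 𝒯.IsAdmissible c β κ) :
    1 ≤ Real.log (T / 𝒯.kMax) ∧ Real.log (T / 𝒯.kMin) ≤ β * Real.log (T / 𝒯.kMax)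
      + |(1 - β) * Real.log T - Real.log c| := by
  have h1 := 𝒯.kMin_pos
  have h2 := h1.trans_le 𝒯.kMin_le_kMax
  have h3 : Real.log (c * 𝒯.kMax ^ β) ≤ Real.log 𝒯.kMin :=
    Real.log_le_log (by positivity) h.kMin_ge
  rw [Real.log_mul hc.ne' (by positivity), Real.log_rpow h2] at h3
  constructor
  -- `k ≤ T / 4` and `e < 4`; this lower bound later lets additive constants be absorbed into the
  -- logarithm.
  · rw [Real.le_log_iff_exp_le (by positivity), le_div_iff₀ h2]
    have h4 := Real.exp_one_lt_d9
    have h5 := h.kMax_le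
    nlinarith
  · rw [Real.log_div hT.ne' h1.ne', Real.log_div hT.ne' h2.ne']
    have := le_abs_self ((1 - β) * Real.log T - Real.log c)
    linarith

end Scheme

/-! ### Maximal regularity for the averaged operators -/

section Estimate

variable {d : ℕ} {Ω : Set (Space d)} {T : ℝ}

/-- Discrete maximal regularity with a general damping parameter `ν`. -/
theorem seqNorm_operatorValue_le {a : Coeff d} {α : ℝ} (hα : 0 < α) {ω : ℝ → ℝ}
    (hω : IsModulus T ω) (ha : IsAdmissibleCoeff Ω T a α ω) {κ ν : ℝ} (hκ : 1 ≤ κ) (hν : 0 ≤ ν)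
    (hsmall : ((3 + κ) * ((d : ℝ) ^ 2 / α)) *
      ∫ s in Ioc 0 T, ω s / s ^ (3 / 2 : ℝ) * Real.exp (-(ν * s)) ≤ 1 / 2)
    (𝒯 : TimeMesh T)
    (hr1 : ∀ i, i + 1 < 𝒯.M → 𝒯.t (i + 1) - 𝒯.t i ≤ κ * (𝒯.t (i + 2) - 𝒯.t (i + 1)))
    (hr2 : ∀ i, i + 1 < 𝒯.M → 𝒯.t (i + 2) - 𝒯.t (i + 1) ≤ κ * (𝒯.t (i + 1) - 𝒯.t i))
    {p : ℝ} (hp : 1 ≤ p) {f : ℝ → L2 Ω} (hf : IntegrableOn f (Ioc 0 T)) {u : ℕ → H10 Ω}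
    (hu : IsDG0Solution a 𝒯 0 f u) :
    seqNorm p (fun i => 𝒯.t (i + 1) - 𝒯.t i) 𝒯.M (fun i => ‖operatorValue 𝒯 f u i‖)
      ≤ Real.exp (ν * (1 + κ) * T) * (2 * (1 + Real.log (T / 𝒯.kMin)) + T)
        * seqNorm p (fun i => 𝒯.t (i + 1) - 𝒯.t i) 𝒯.M (fun i => ‖meanValue 𝒯 f i‖) := by
  have hB : ∀ i, ∃ B : H10 Ω →L[ℝ] H10 Ω →L[ℝ] ℝ, i < 𝒯.M →
      (∀ u v, B u v = avgOp a 𝒯 (i + 1) u v) ∧ (∀ u v, B u v = B v u) ∧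
        ∀ u, α * gradSq u ≤ B u u := by
    intro i
    by_cases hi : i < 𝒯.M
    · obtain ⟨B, hB⟩ := exists_avgOp_bilinear (𝒯 := 𝒯) ha hi
      exact ⟨B, fun _ => hB⟩
    · exact ⟨0, fun h => absurd h hi⟩
  choose B hB using hB
  have hB0 : ∀ i < 𝒯.M, ∀ w, 0 ≤ B i w w := fun i hi w =>
    (mul_nonneg hα.le (gradSq_nonneg w)).trans ((hB i hi).2.2 w)
  -- The form controls only the gradient, and no Poincaré inequality is assumed on `Ω`; the `L²`
  -- term supplies the rest of the `H¹` norm.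
  have hcoer : ∀ i < 𝒯.M, ∀ w, min 1 α * ‖w‖ ^ 2 ≤ ‖embL2 Ω w‖ ^ 2 + B i w w := by
    intro i hi w
    rw [norm_sq_eq_add_gradSq, mul_add]
    refine add_le_add ?_ (le_trans ?_ ((hB i hi).2.2 w))
    · exact mul_le_of_le_one_left (sq_nonneg _) (min_le_left _ _)
    · exact mul_le_mul_of_nonneg_right (min_le_right _ _) (gradSq_nonneg w)
  have hs : IsEulerScheme (embL2 Ω) B 𝒯.M 𝒯.t (fun i => u (i + 1)) (nodalValue u)
      (meanValue 𝒯 f) (operatorValue 𝒯 f u) := by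
    refine ⟨rfl, fun i _ => rfl, fun i hi => ?_, fun i hi w => ?_⟩
    · have := (𝒯.step_pos hi).ne'
      rw [operatorValue, ← 𝒯.step_succ, smul_sub, smul_inv_smul₀ this]
      abel
    · rw [(hB i hi).1, hu.isL2Rep hf hi]
      rfl
  have hgrad : ∀ i < 𝒯.M, ∀ w, √(gradSq w) ≤ √(B i w w) / √α := by
    intro i hi w
    rw [← Real.sqrt_div' _ hα.le]
    refine Real.sqrt_le_sqrt ?_
    rw [le_div_iff₀ hα, mul_comm]
    exact (hB i hi).2.2 w
  -- Testing with the solution itself gives `B i (v, v) = (g i, U (i+1))`, and `√(ab) ≤ a + b` for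
  -- nonnegative `a, b`. This makes the perturbation linear in `‖g‖` and `‖U‖`.
  have hgradU : ∀ i < 𝒯.M, √(gradSq (u (i + 1))) ≤
      (‖operatorValue 𝒯 f u i‖ + ‖nodalValue u (i + 1)‖) / √α := by
    intro i hi
    refine (hgrad i hi _).trans ?_
    gcongr
    rw [Real.sqrt_le_left (by positivity), hs.apply i hi]
    refine (real_inner_le_norm _ _).trans ?_
    show ‖operatorValue 𝒯 f u i‖ * ‖nodalValue u (i + 1)‖ ≤ _
    nlinarith [norm_nonneg (operatorValue 𝒯 f u i), norm_nonneg (nodalValue u (i + 1))]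
  have hmem : ∀ l m, l ≤ m → m < 𝒯.M → 𝒯.t (m + 1) - 𝒯.t l ∈ Ioc 0 T := fun l m hlm hm => by
    refine ⟨sub_pos.2 (mesh_lt 𝒯.t_lt (by omega) hm), ?_⟩
    have h1 := 𝒯.t_mono (Nat.succ_le_of_lt hm) le_rfl
    have h2 := 𝒯.t_mono (Nat.zero_le l) (by omega)
    have h3 := 𝒯.t_last
    have h4 := 𝒯.t_zero
    rw [Nat.succ_eq_add_one] at h1
    linarith
  have hω0 : ∀ s ∈ Ioc 0 T, 0 ≤ ω s := fun s hs => hω.nonneg s ⟨hs.1.le, hs.2⟩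
  have hεT : 𝒯.kMin ≤ T := by
    have h1 := 𝒯.kMin_le (i := 0) 𝒯.one_le
    have h2 := (hmem 0 0 le_rfl 𝒯.one_le).2
    exact h1.trans h2
  have hα' : √α * √α = α := Real.mul_self_sqrt hα.le
  refine seqNorm_gronwall (g := fun s => ω s / s ^ (3 / 2 : ℝ))
    (W := fun i => ‖nodalValue u (i + 1)‖) hp 𝒯.t_zero 𝒯.t_last 𝒯.t_lt hω.antitoneOn
    (fun s hs => div_nonneg (hω0 s hs) (Real.rpow_nonneg hs.1.le _)) hω.integrableOn
    (zero_le_one.trans hκ) hν (by positivity) hsmall 𝒯.kMin_pos hεT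
    (fun i hi => 𝒯.kMin_le hi) hr1 (fun _ _ => norm_nonneg _) (fun _ _ => norm_nonneg _)
    (fun _ _ => norm_nonneg _) (fun m hm => ?_)
    (fun m hm => hs.norm_le hB0 𝒯.t_lt (m + 1) hm)
  have hD0 : ∀ l < m, 0 ≤ ω (𝒯.t (m + 1) - 𝒯.t l) * ((d : ℝ) ^ 2 / α) *
      (‖operatorValue 𝒯 f u l‖ + ‖nodalValue u (l + 1)‖) := by
    intro l hl
    have := hω0 _ (hmem l m hl.le hm)
    positivity
  have hdiff : ∀ l < m, ∀ w, |B m (u (l + 1)) w - B l (u (l + 1)) w| ≤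
      ω (𝒯.t (m + 1) - 𝒯.t l) * ((d : ℝ) ^ 2 / α) *
        (‖operatorValue 𝒯 f u l‖ + ‖nodalValue u (l + 1)‖) * √(B m w w) := by
    intro l hl w
    have hl' : l < 𝒯.M := hl.trans hm
    rw [(hB m hm).1, (hB l hl').1]
    refine (abs_avgOp_sub_le ha hω hl.le hm _ _).trans ?_
    have h1 := hω0 _ (hmem l m hl.le hm)
    calc ω (𝒯.t (m + 1) - 𝒯.t l) * (d : ℝ) ^ 2 * (√(gradSq (u (l + 1))) * √(gradSq w))
        ≤ ω (𝒯.t (m + 1) - 𝒯.t l) * (d : ℝ) ^ 2 *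
          ((‖operatorValue 𝒯 f u l‖ + ‖nodalValue u (l + 1)‖) / √α * (√(B m w w) / √α)) := by
          gcongr
          · exact hgradU l hl'
          · exact hgrad m hm w
      _ = _ := by
          rw [div_mul_div_comm, hα']
          ring
  have hmain := hs.norm_operator_le hB0 (fun i hi => (hB i hi).2.1) (lt_min one_pos hα) hcoer
    𝒯.t_lt hκ hr1 hr2 hm _ hD0 hdiff
  refine hmain.trans (le_of_eq ?_)
  congr 1
  rw [mul_assoc, Finset.mul_sum _ _ ((d : ℝ) ^ 2 / α)]
  congr 1
  refine Finset.sum_congr rfl fun l _ => ?_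
  ring

end Estimate

end DG

/-! ### Choice of constants and conclusion -/

theorem corollary3p3 {d : ℕ} (hd : 1 ≤ d) (Ω : Set (DG.Space d)) (hΩ : IsOpen Ω)
    (T : ℝ) (hT : 0 < T)
    (a : DG.Coeff d) (α : ℝ) (hα : 0 < α) (ω : ℝ → ℝ) (hω : DG.IsModulus T ω)
    (ha : DG.IsAdmissibleCoeff Ω T a α ω)
    (c β κ : ℝ) (hc : 0 < c) (hβ : 0 < β) (hκ : 0 < κ) :
    ∃ μ > 0, ∃ δ₀ > 0, ∃ C > 0,
      ∀ 𝒯 : DG.TimeMesh T, 𝒯.IsAdmissible c β κ → 𝒯.kMax - 𝒯.kMin ≤ δ₀ →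
      ∀ p : ℝ, 1 ≤ p →
      ∀ f : ℝ → DG.L2 Ω, MemLp f (ENNReal.ofReal p) (volume.restrict (Ioo 0 T)) →
      ∀ u : ℕ → DG.H10 Ω, DG.IsDG0Solution a 𝒯 0 f u →
      ∃ Au : ℕ → DG.L2 Ω,
        (∀ m ∈ Finset.Icc 1 𝒯.M, DG.IsL2Rep (DG.avgOp a 𝒯 m (u m)) (Au m)) ∧
        (∑ m ∈ Finset.Icc 1 𝒯.M,
            (DG.timeNorm p (𝒯.interval m) (fun _ => Au m) ^ p
              + 𝒯.step m * ‖(𝒯.step m)⁻¹ • DG.jump 0 u m‖ ^ p)) ^ (1 / p)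
          ≤ C * Real.exp (μ * T) * Real.log (T / 𝒯.kMax) * DG.timeNorm p (Ioo 0 T) f := by
  -- The reversed chain needs a ratio bound of at least 1.
  set κ' := max 1 κ with hκ'
  have hκ1 : 1 ≤ κ' := le_max_left _ _
  have hκ0 : 0 < κ' := one_pos.trans_le hκ1
  set C₁ := (3 + κ') * ((d : ℝ) ^ 2 / α) with hC₁
  have hC₁0 : 0 ≤ C₁ := by positivity
  obtain ⟨ν, hν, hνle⟩ := DG.exists_damping hω.integrableOn
    (show 0 < 1 / (2 * (C₁ + 1)) by positivity)
  have hsmall : C₁ * ∫ s in Ioc 0 T, ω s / s ^ (3 / 2 : ℝ) * Real.exp (-(ν * s)) ≤ 1 / 2 := by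
    refine (mul_le_mul_of_nonneg_left hνle hC₁0).trans ?_
    rw [mul_one_div, div_le_div_iff₀ (by positivity) (by positivity)]
    linarith
  set E := |(1 - β) * Real.log T - Real.log c| with hE
  have hE0 : 0 ≤ E := abs_nonneg _
  -- Since `1 ≤ log (T / k)`, the factor `2 (1 + log (T / k_min)) + T` is at most `(2 + 2β + 2E + T)
  -- log (T / k)`.
  set D := Real.exp (ν * (1 + κ') * T) * (2 + 2 * β + 2 * E + T) with hD
  have hD0 : 0 < D := by positivity
  -- `T` is fixed before the constants, so the exponential growth sits in `D` and any `μ > 0` would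
  -- do. In `2 * D + 1`, one `D` bounds the operator values; the other `D` and the 1 bound the jump
  -- quotients, which are `f` minus the operator values.
  refine ⟨1, one_pos, 1, one_pos, 2 * D + 1, by positivity, ?_⟩
  intro 𝒯 h𝒯 _ p hp f hf u hu
  have hp0 : 0 < p := by positivity
  obtain ⟨hL1, hL2⟩ := DG.log_div_kMin_le hT hc h𝒯
  set Lg := Real.log (T / 𝒯.kMax) with hLg
  have hf1 : IntegrableOn f (Ioc 0 T) := by
    have := hf.integrable (by simpa using hp)
    rwa [restrict_Ioo_eq_restrict_Ioc] at this
  have hk : ∀ i < 𝒯.M, 0 ≤ 𝒯.t (i + 1) - 𝒯.t i := fun i hi => sub_nonneg.2 (𝒯.t_lt i hi).le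
  have hr : ∀ i, i + 1 < 𝒯.M →
      𝒯.t (i + 1) - 𝒯.t i ≤ κ' * (𝒯.t (i + 2) - 𝒯.t (i + 1)) ∧
      𝒯.t (i + 2) - 𝒯.t (i + 1) ≤ κ' * (𝒯.t (i + 1) - 𝒯.t i) := by
    intro i hi
    obtain ⟨h1, h2⟩ := h𝒯.ratio (i + 1) (by omega) hi
    have hp2 := 𝒯.step_pos hi
    have hp1 := 𝒯.step_pos (show i < 𝒯.M by omega)
    rw [div_le_iff₀ hp2] at h2
    rw [le_div_iff₀ hp2, inv_mul_le_iff₀ hκ] at h1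
    exact ⟨h2.trans (mul_le_mul_of_nonneg_right (le_max_right _ _) hp2.le),
      h1.trans (mul_le_mul_of_nonneg_right (le_max_right _ _) hp1.le)⟩
  have hx := DG.seqNorm_operatorValue_le hα hω ha hκ1 hν hsmall 𝒯 (fun i hi => (hr i hi).1)
    (fun i hi => (hr i hi).2) hp hf1 hu
  have hF := DG.seqNorm_meanValue_le (𝒯 := 𝒯) hp hf
  set k : ℕ → ℝ := fun i => 𝒯.t (i + 1) - 𝒯.t i with hkdef
  set x : ℕ → ℝ := fun i => ‖DG.operatorValue 𝒯 f u i‖ with hxdef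
  set F : ℕ → ℝ := fun i => ‖DG.meanValue 𝒯 f i‖ with hFdef
  set J : ℕ → ℝ := fun i => ‖(𝒯.step (i + 1))⁻¹ • DG.jump 0 u (i + 1)‖ with hJdef
  have hx0 : ∀ i < 𝒯.M, 0 ≤ x i := fun _ _ => norm_nonneg _
  have hF0 : ∀ i < 𝒯.M, 0 ≤ F i := fun _ _ => norm_nonneg _
  have hJ0 : ∀ i < 𝒯.M, 0 ≤ J i := fun _ _ => norm_nonneg _
  have hJ : ∀ i < 𝒯.M, J i ≤ F i + x i := by
    intro i _
    have : (𝒯.step (i + 1))⁻¹ • DG.jump 0 u (i + 1)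
        = DG.meanValue 𝒯 f i - DG.operatorValue 𝒯 f u i := by
      rw [DG.operatorValue, DG.jump_succ, sub_sub_cancel]
    simp only [hJdef, this]
    exact norm_sub_le _ _
  have hJn : DG.seqNorm p k 𝒯.M J ≤ DG.seqNorm p k 𝒯.M F + DG.seqNorm p k 𝒯.M x :=
    (DG.seqNorm_mono hp hk hJ0 hJ).trans (DG.seqNorm_add_le hp hk hF0 hx0)
  have hFn := DG.seqNorm_nonneg (p := p) hk hF0
  refine ⟨fun m => DG.operatorValue 𝒯 f u (m - 1), fun m hm => ?_, ?_⟩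
  · obtain ⟨h1, h2⟩ := Finset.mem_Icc.1 hm
    obtain ⟨i, rfl⟩ : ∃ i, m = i + 1 := ⟨m - 1, by omega⟩
    exact hu.isL2Rep hf1 h2
  have hsum : ∑ m ∈ Finset.Icc 1 𝒯.M,
      (DG.timeNorm p (𝒯.interval m) (fun _ => DG.operatorValue 𝒯 f u (m - 1)) ^ p
        + 𝒯.step m * ‖(𝒯.step m)⁻¹ • DG.jump 0 u m‖ ^ p)
      = (∑ i ∈ Finset.range 𝒯.M, k i * x i ^ p) + ∑ i ∈ Finset.range 𝒯.M, k i * J i ^ p := by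
    rw [DG.sum_Icc_one_eq, ← Finset.sum_add_distrib]
    refine Finset.sum_congr rfl fun i hi => ?_
    rw [Nat.add_sub_cancel, DG.timeNorm_const_rpow hp (Finset.mem_range.1 hi)]
    rfl
  have hsx : 0 ≤ ∑ i ∈ Finset.range 𝒯.M, k i * x i ^ p := Finset.sum_nonneg fun i hi =>
    mul_nonneg (hk i (Finset.mem_range.1 hi)) (Real.rpow_nonneg (norm_nonneg _) _)
  have hsJ : 0 ≤ ∑ i ∈ Finset.range 𝒯.M, k i * J i ^ p := Finset.sum_nonneg fun i hi =>
    mul_nonneg (hk i (Finset.mem_range.1 hi)) (Real.rpow_nonneg (norm_nonneg _) _)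
  have hxL : DG.seqNorm p k 𝒯.M x ≤ D * Lg * DG.seqNorm p k 𝒯.M F := by
    refine hx.trans (mul_le_mul_of_nonneg_right ?_ hFn)
    rw [hD, mul_assoc (Real.exp _)]
    refine mul_le_mul_of_nonneg_left ?_ (Real.exp_pos _).le
    nlinarith
  -- `x ↦ x ^ (1/p)` is subadditive because `1/p ≤ 1`.
  calc _ ≤ DG.seqNorm p k 𝒯.M x + DG.seqNorm p k 𝒯.M J := by
        rw [hsum]
        exact Real.rpow_add_le_add_rpow hsx hsJ (by positivity) ((div_le_one hp0).2 hp)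
    _ ≤ (2 * D * Lg + 1) * DG.seqNorm p k 𝒯.M F := by linarith
    _ ≤ ((2 * D + 1) * Lg) * DG.timeNorm p (Ioo 0 T) f := by
        refine mul_le_mul ?_ hF hFn (by positivity)
        linarith
    _ ≤ (2 * D + 1) * Real.exp (1 * T) * Lg * DG.timeNorm p (Ioo 0 T) f := by
        have h1 : 1 ≤ Real.exp (1 * T) := Real.one_le_exp (by linarith)
        have h2 : 0 ≤ DG.timeNorm p (Ioo 0 T) f := ENNReal.toReal_nonneg
        have h3 : 0 ≤ (2 * D + 1) * Lg := by positivity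
        refine mul_le_mul_of_nonneg_right ?_ h2
        nlinarith
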